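/- Let $F$ be a field which is complete for a non-trivial ultrametric absolute value $|\cdot|$, and let $R>0$ be a real number. Let $F\langle T/R\rangle$ be the algebra of power series $\sum_n c_nT^n\in F[[T]]$ such that $|c_n|R^n\to 0$. For a power series $\phi=\sum_n c_nT^n\in F[[T]]$, put $$\|\phi\|_r=\sup_n|c_n|r^n\in[0,+\infty],\qquad \tau_\phi(x)=\log\|\phi\|_{e^x},\qquad \nu_\phi(t)=\sup_{x\in\mathbb R}\bigl(xt-\tau_\phi(x)\bigr)\in[-\infty,+\infty]\quad(x,t\in\mathbb R),$$ and let $R_\phi=(\limsup_n|c_n|^{1/n})^{-1}\in[0,+\infty]$ be its radius of convergence. The function $\nu_\phi$ is the Newton polygon of $\phi$; a real number $\mu$ is called a slope of $\nu_\phi$ if $\nu_\phi$ is finite and affine of slope $\mu$ on some interval $[a,b]$ with $a<b$. Let $\phi=\sum_n c_nT^n\in F\langle T/R\rangle$. Assume that $\phi$ is not a polynomial and that $\phi(0)=c_0\neq0$. Then: 1. The function $\nu_\phi$ is finite on $\mathbb R_+=[0,+\infty)$; it is continuous, convex and piecewise affine there (with a locally finite set of subdivision points). 2. The real numbers $t$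 such that $\nu_\phi$ is finite at $t$ and not differentiable at $t$ are non-negative integers such that $\nu_\phi(t)=-\log|c_t|$. Let $n_0<n_1<\cdots$ be the strictly increasing (finite or infinite) sequence of these integers. One has $n_0=0$. 3. Let $a\in F$ be such that $|a|\le R$ and $\phi(a)=0$. Then $\log|a|$ is a slope of $\nu_\phi$. 4. Let $m\ge1$ be an integer such that $n_m$ is defined. Then $\nu_\phi$ is affine on $[n_{m-1},n_m]$; let $\mu$ be its slope there. One has $\mu<\log R_\phi$. If moreover $\mu\le\log R$, there exists a unique pair $(P,\psi)$, where $P\in F[T]$ is a polynomial of degree $n_m-n_{m-1}$ such that $P(0)=1$ and whose Newton polygon $\nu_P$ has $\mu$ as its only slope, and where $\psi\in F\langle T/R\rangle$, such that $\phi=P\psi$. Moreover, $\mu$ is not a slope of $\nu_\psi$. -/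

import Mathlib

open Set Filter Topology
open scoped ENNReal Polynomial PowerSeries

noncomputable section

section Series

variable {F : Type*} [NormedField F]

/-- `‖φ‖_r = sup_n |c_n| r ^ n`, an element of `[0, ∞]`, for `φ = ∑ c_n T ^ n` and `r ≥ 0`. -/
def supNorm (φ : F⟦X⟧) (r : ℝ) : ℝ≥0∞ :=
  ⨆ n : ℕ, ‖PowerSeries.coeff n φ‖ₑ * ENNReal.ofReal r ^ n

/-- The tropical function `τ_φ(x) = log ‖φ‖_{e ^ x}`, with values in `[-∞, +∞]`. -/
def tropical (φ : F⟦X⟧) (x : ℝ) : EReal :=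
  ENNReal.log (supNorm φ (Real.exp x))

/-- The Newton polygon of `φ`: the Legendre transform
`ν_φ(t) = sup_x (x t - τ_φ(x))`, with values in `[-∞, +∞]`. -/
def newtonPolygon (φ : F⟦X⟧) (t : ℝ) : EReal :=
  ⨆ x : ℝ, (((x * t : ℝ) : EReal) - tropical φ x)

/-- The radius of convergence `R_φ = (limsup |c_n| ^ (1 / n))⁻¹`, in `[0, ∞]`. -/
def convergenceRadius (φ : F⟦X⟧) : ℝ≥0∞ :=
  (limsup (fun n : ℕ => ‖PowerSeries.coeff n φ‖ₑ ^ (1 / (n : ℝ))) atTop)⁻¹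

end Series

section Polygon

/-- `f` takes finite values on a neighbourhood of `t` and is differentiable at `t`. -/
def ERealDifferentiableAt (f : ℝ → EReal) (t : ℝ) : Prop :=
  ∃ g : ℝ → ℝ, DifferentiableAt ℝ g t ∧ ∀ᶠ s in 𝓝 t, f s = (g s : EReal)

/-- `f` is finite at `t` and not differentiable at `t`. -/
def IsBreakPoint (f : ℝ → EReal) (t : ℝ) : Prop :=
  f t ≠ ⊥ ∧ f t ≠ ⊤ ∧ ¬ ERealDifferentiableAt f t

/-- `a < b` are two consecutive break points of `f`. -/
def ConsecutiveBreakPoints (f : ℝ → EReal) (a b : ℝ) : Prop :=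
  a < b ∧ IsBreakPoint f a ∧ IsBreakPoint f b ∧ ∀ t ∈ Ioo a b, ¬ IsBreakPoint f t

/-- `a < b`, and `f` is finite and affine of slope `μ` on `[a, b]`. -/
def HasSlopeOn (f : ℝ → EReal) (μ a b : ℝ) : Prop :=
  a < b ∧ ∃ q : ℝ, ∀ t ∈ Icc a b, f t = ((μ * t + q : ℝ) : EReal)

/-- `μ` is a slope of `f`: `f` is affine of slope `μ` on some nondegenerate interval. -/
def IsSlope (f : ℝ → EReal) (μ : ℝ) : Prop :=
  ∃ a b : ℝ, HasSlopeOn f μ a b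

/-- `f` is finite and piecewise affine on `[0, +∞)`: there is a locally finite set `S` of
subdivision points such that `f` is affine on every interval with no point of `S` inside. -/
def PiecewiseAffineOnNonneg (f : ℝ → EReal) : Prop :=
  ∃ S : Set ℝ, (∀ a b : ℝ, (S ∩ Icc a b).Finite) ∧
    ∀ a b : ℝ, 0 ≤ a → a < b → Disjoint S (Ioo a b) → ∃ p : ℝ, HasSlopeOn f p a b

end Polygon

/-- `φ = P ψ`, where `P` is a polynomial of degree `d` with `P(0) = 1` whose Newton polygon has
`μ` as its only slope, and where `ψ` belongs to the Tate algebra of radius `R`. -/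
def IsSlopeFactorization {F : Type*} [NormedField F] (R : ℝ) (φ : F⟦X⟧) (d : ℕ) (μ : ℝ)
    (P : F[X]) (ψ : F⟦X⟧) : Prop :=
  P.natDegree = d ∧ P.eval 0 = 1 ∧
    (∀ s : ℝ, IsSlope (newtonPolygon (P : F⟦X⟧)) s ↔ s = μ) ∧
    PowerSeries.IsRestricted R ψ ∧ φ = (P : F⟦X⟧) * ψ

end

/-! Everything is read off from the indices n at which |c_n| r^n is maximal (`DominantAt`), for a
given radius r = e^x. If i ≤ j are both dominant at r, the supremum defining ν is attained at x =
log r for every t between i and j, so ν has slope log r there. For each n, the critical radius s n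
is the largest one at which some index ≤ n is still dominant; it exists because φ has a nonzero
coefficient beyond n, and ν has slope log (s n) on [n, n + 1] (`IsCritical.newtonPolygon_eq`). This
determines ν on [0, ∞), while ν = ∞ to the left of 0. Positive break points are the integers where s
jumps, and consecutive break points k < l are the first and last dominant indices at radius s k
(`ConsecutiveBreakPoints.dominant`).

A zero a forces two dominant terms at radius |a|, since a single one would determine the norm of the
sum.

The ultrametric inequality makes first and last dominant indices additive in products
(`FirstDominant.mul`, `LastDominant.mul`). Hence P uses up the whole edge of slope μ and leaves ψ
with a single dominant index, which yields both uniqueness and the absence of the slope μ in ψ.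

Existence is a Hensel argument (`exists_factorization`). After normalising c_k = 1, the part of φ in
degrees k, …, l is T^k P₀, and the rest is smaller at radius s k by a factor ε < 1. Restricted
series are approximated by P₀ A + T^k D with A and D controlled, so the approximate factorization P₀
· T^k can be corrected repeatedly; since D lives in degrees 1, …, l - k, the corrections preserve
P(0) = 1 and the degree bound. Finally `PowerSeries.IsRestricted.of_mul` carries ψ from radius s k
to radius R. -/

/-! ### Dominant indices of a power series at a given radius -/

section Dominance

variable {F : Type*} [NormedField F]

/-- The term of index `i` of `f` has maximal norm `‖f_i‖ * r ^ i`, and is nonzero. -/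
def DominantAt (r : ℝ) (f : F⟦X⟧) (i : ℕ) : Prop :=
  PowerSeries.coeff i f ≠ 0 ∧
    ∀ j, ‖PowerSeries.coeff j f‖ * r ^ j ≤ ‖PowerSeries.coeff i f‖ * r ^ i

/-- `i` is the smallest dominant index of `f` at radius `r`. -/
def FirstDominant (r : ℝ) (f : F⟦X⟧) (i : ℕ) : Prop :=
  DominantAt r f i ∧
    ∀ j < i, ‖PowerSeries.coeff j f‖ * r ^ j < ‖PowerSeries.coeff i f‖ * r ^ i

/-- `i` is the largest dominant index of `f` at radius `r`. -/
def LastDominant (r : ℝ) (f : F⟦X⟧) (i : ℕ) : Prop :=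
  DominantAt r f i ∧
    ∀ j, i < j → ‖PowerSeries.coeff j f‖ * r ^ j < ‖PowerSeries.coeff i f‖ * r ^ i

lemma term_nonneg {r : ℝ} (hr : 0 < r) (f : F⟦X⟧) (i : ℕ) :
    0 ≤ ‖PowerSeries.coeff i f‖ * r ^ i := by positivity

lemma term_pos {r : ℝ} (hr : 0 < r) {f : F⟦X⟧} {i : ℕ} (h : PowerSeries.coeff i f ≠ 0) :
    0 < ‖PowerSeries.coeff i f‖ * r ^ i := by positivity

lemma DominantAt.term_eq {r : ℝ} {f : F⟦X⟧} {i j : ℕ} (hi : DominantAt r f i)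
    (hj : DominantAt r f j) :
    ‖PowerSeries.coeff i f‖ * r ^ i = ‖PowerSeries.coeff j f‖ * r ^ j :=
  le_antisymm (hj.2 i) (hi.2 j)

lemma FirstDominant.le {r : ℝ} {f : F⟦X⟧} {i j : ℕ} (hi : FirstDominant r f i)
    (hj : DominantAt r f j) : i ≤ j := by
  by_contra h
  exact absurd (hi.2 j (by omega)) (not_lt.2 (hj.2 i))

lemma LastDominant.le {r : ℝ} {f : F⟦X⟧} {i j : ℕ} (hi : LastDominant r f i)
    (hj : DominantAt r f j) : j ≤ i := by
  by_contra h
  exact absurd (hi.2 j (by omega)) (not_lt.2 (hj.2 i))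

lemma FirstDominant.unique {r : ℝ} {f : F⟦X⟧} {i j : ℕ} (hi : FirstDominant r f i)
    (hj : FirstDominant r f j) : i = j :=
  le_antisymm (hi.le hj.1) (hj.le hi.1)

lemma LastDominant.unique {r : ℝ} {f : F⟦X⟧} {i j : ℕ} (hi : LastDominant r f i)
    (hj : LastDominant r f j) : i = j :=
  le_antisymm (hj.le hi.1) (hi.le hj.1)

lemma isRestricted_iff_tendsto {r : ℝ} {f : F⟦X⟧} :
    PowerSeries.IsRestricted r f ↔
      Tendsto (fun n : ℕ => ‖PowerSeries.coeff n f‖ * r ^ n) atTop (𝓝 0) :=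
  PowerSeries.isRestricted_iff' _ _

lemma isRestricted_of_forall_lt {r : ℝ} (f : F⟦X⟧) (d : ℕ)
    (h : ∀ n, d < n → PowerSeries.coeff n f = 0) : PowerSeries.IsRestricted r f := by
  rw [isRestricted_iff_tendsto]
  refine tendsto_const_nhds.congr' ?_
  filter_upwards [eventually_gt_atTop d] with n hn
  simp [h n hn]

lemma isRestricted_coe (r : ℝ) (P : F[X]) : PowerSeries.IsRestricted r (P : F⟦X⟧) :=
  isRestricted_of_forall_lt _ P.natDegree fun n hn => by
    rw [Polynomial.coeff_coe, Polynomial.coeff_eq_zero_of_natDegree_lt hn]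

lemma PowerSeries.IsRestricted.of_le {r s : ℝ} (hr : 0 < r) (hrs : r ≤ s) {f : F⟦X⟧}
    (hf : PowerSeries.IsRestricted s f) : PowerSeries.IsRestricted r f := by
  rw [isRestricted_iff_tendsto] at *
  refine squeeze_zero (fun n => term_nonneg hr f n) (fun n => ?_) hf
  gcongr

lemma PowerSeries.IsRestricted.exists_bound {r : ℝ} {f : F⟦X⟧}
    (hf : PowerSeries.IsRestricted r f) :
    ∃ M : ℝ, 0 < M ∧ ∀ n, ‖PowerSeries.coeff n f‖ * r ^ n ≤ M := by
  rw [isRestricted_iff_tendsto] at hf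
  obtain ⟨M, hM⟩ := hf.bddAbove_range
  exact ⟨max M 1, by positivity, fun n => (hM ⟨n, rfl⟩).trans (le_max_left _ _)⟩

lemma isRestricted_of_bound {r s M : ℝ} (hr : 0 < r) (hrs : r < s) {f : F⟦X⟧}
    (hf : ∀ n, ‖PowerSeries.coeff n f‖ * s ^ n ≤ M) : PowerSeries.IsRestricted r f := by
  rw [isRestricted_iff_tendsto]
  have hs : 0 < s := hr.trans hrs
  have h : Tendsto (fun n : ℕ => M * (r / s) ^ n) atTop (𝓝 0) := by
    simpa using (tendsto_pow_atTop_nhds_zero_of_lt_one (by positivity)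
      ((div_lt_one hs).2 hrs)).const_mul M
  refine squeeze_zero (fun n => term_nonneg hr f n) (fun n => ?_) h
  have : ‖PowerSeries.coeff n f‖ * r ^ n =
      ‖PowerSeries.coeff n f‖ * s ^ n * (r / s) ^ n := by
    rw [div_pow]; field_simp
  rw [this]
  exact mul_le_mul_of_nonneg_right (hf n) (by positivity)

/-- A sequence tending to zero whose terms over `S` are `< M` is bounded there by some `B < M`. -/
lemma exists_lt_bound_of_tendsto_zero {u : ℕ → ℝ} (hu : Tendsto u atTop (𝓝 0)) {M : ℝ}
    (hM : 0 < M) (S : Set ℕ) (h : ∀ n ∈ S, u n < M) :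
    ∃ B, 0 < B ∧ B < M ∧ ∀ n ∈ S, u n ≤ B := by
  obtain ⟨N, hN⟩ := eventually_atTop.1 (hu.eventually_lt_const (half_pos hM))
  have key : ∀ N : ℕ, ∃ B, 0 < B ∧ B < M ∧ ∀ n ∈ S, n < N → u n ≤ B := by
    intro N
    induction N with
    | zero => exact ⟨M / 2, by positivity, by linarith, fun n _ hn => absurd hn (by omega)⟩
    | succ N ih =>
      obtain ⟨B, hB0, hBM, hB⟩ := ih
      by_cases hNS : N ∈ S
      · refine ⟨max B (u N), lt_max_of_lt_left hB0, max_lt hBM (h N hNS), fun n hn hnN => ?_⟩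
        rcases Nat.lt_succ_iff_lt_or_eq.1 hnN with h' | rfl
        · exact (hB n hn h').trans (le_max_left _ _)
        · exact le_max_right _ _
      · refine ⟨B, hB0, hBM, fun n hn hnN => ?_⟩
        rcases Nat.lt_succ_iff_lt_or_eq.1 hnN with h' | rfl
        · exact hB n hn h'
        · exact absurd hn hNS
  obtain ⟨B, hB0, hBM, hB⟩ := key N
  refine ⟨max B (M / 2), lt_max_of_lt_left hB0, max_lt hBM (by linarith), fun n hn => ?_⟩
  by_cases hnN : n < N
  · exact (hB n hn hnN).trans (le_max_left _ _)
  · exact (hN n (not_lt.1 hnN)).le.trans (le_max_right _ _)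

/-- Over any set of indices containing a positive term, a sequence tending to zero has a last
index where it is maximal. -/
lemma exists_last_max {u : ℕ → ℝ} (hu : Tendsto u atTop (𝓝 0)) (S : Set ℕ) {m : ℕ}
    (hm : m ∈ S) (hum : 0 < u m) :
    ∃ i ∈ S, (∀ j ∈ S, u j ≤ u i) ∧ ∀ j ∈ S, i < j → u j < u i := by
  classical
  obtain ⟨N, hN⟩ := eventually_atTop.1 (hu.eventually_lt_const hum)
  have hmN : m < N := by
    by_contra h
    exact lt_irrefl _ (hN m (not_lt.1 h))
  obtain ⟨i₀, hi₀, hmax⟩ := ((Finset.range N).filter (· ∈ S)).exists_max_image u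
    ⟨m, by simp [hm, hmN]⟩
  have hall : ∀ j ∈ S, u j ≤ u i₀ := fun j hj => by
    by_cases hjN : j < N
    · exact hmax j (by simp [hj, hjN])
    · exact (hN j (not_lt.1 hjN)).le.trans (hmax m (by simp [hm, hmN]))
  obtain ⟨i, hi, hlast⟩ := ((Finset.range N).filter (fun j => j ∈ S ∧ u j = u i₀)).exists_max_image
    id ⟨i₀, by simpa using hi₀⟩
  simp only [Finset.mem_filter, Finset.mem_range, id] at hi hlast
  refine ⟨i, hi.2.1, fun j hj => hi.2.2 ▸ hall j hj, fun j hj hij => ?_⟩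
  refine lt_of_le_of_ne (hi.2.2 ▸ hall j hj) fun he => ?_
  by_cases hjN : j < N
  · exact absurd (hlast j ⟨hjN, hj, he.trans hi.2.2⟩) (by omega)
  · have := hN j (not_lt.1 hjN)
    rw [he, hi.2.2] at this
    exact absurd this (not_lt.2 (hall m hm))

lemma exists_lastDominant {r : ℝ} (hr : 0 < r) {f : F⟦X⟧} (hf : PowerSeries.IsRestricted r f)
    (hf0 : f ≠ 0) : ∃ i, LastDominant r f i := by
  obtain ⟨m, hm⟩ : ∃ m, PowerSeries.coeff m f ≠ 0 := by
    by_contra! h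
    exact hf0 (PowerSeries.ext (by simpa using h))
  obtain ⟨i, -, h1, h2⟩ := exists_last_max (isRestricted_iff_tendsto.1 hf) univ (mem_univ m)
    (term_pos hr hm)
  refine ⟨i, ⟨fun h => ?_, fun j => h1 j (mem_univ j)⟩, fun j => h2 j (mem_univ j)⟩
  have := h1 m (mem_univ m)
  rw [h, norm_zero, zero_mul] at this
  exact absurd (term_pos hr hm) (not_lt.2 this)

lemma DominantAt.exists_firstDominant {r : ℝ} (hr : 0 < r) {f : F⟦X⟧} {i : ℕ}
    (h : DominantAt r f i) : ∃ i, FirstDominant r f i := by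
  classical
  have hex : ∃ i, DominantAt r f i := ⟨i, h⟩
  have hs := Nat.find_spec hex
  refine ⟨Nat.find hex, hs, fun j hj => ?_⟩
  by_contra hlt
  rw [not_lt] at hlt
  refine Nat.find_min hex hj ⟨fun h0 => ?_, fun i => (hs.2 i).trans hlt⟩
  rw [h0, norm_zero, zero_mul] at hlt
  exact absurd (term_pos hr hs.1) (not_lt.2 hlt)

lemma LastDominant.not_eq_zero {r : ℝ} {f : F⟦X⟧} {i : ℕ} (h : LastDominant r f i) : f ≠ 0 := by
  rintro rfl
  exact h.1.1 (by simp)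

/-- If `k` is the only dominant index at `r` and `f` is restricted at some larger radius, then `k`
is dominant at all radii close to `r`. -/
lemma eventually_dominantAt {r s : ℝ} (hr : 0 < r) (hrs : r < s) {f : F⟦X⟧} {k : ℕ}
    (hf : PowerSeries.IsRestricted s f) (h1 : FirstDominant r f k) (h2 : LastDominant r f k) :
    ∀ᶠ ρ in 𝓝 r, DominantAt ρ f k := by
  have hpos : 0 < ‖PowerSeries.coeff k f‖ * r ^ k := term_pos hr h1.1.1
  have hcont : ∀ j : ℕ, Continuous fun ρ : ℝ => ‖PowerSeries.coeff j f‖ * ρ ^ j :=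
    fun j => by fun_prop
  -- Beyond N the terms are below half the maximum already at radius s, hence at every radius up to
  -- s; only finitely many indices are left to continuity.
  obtain ⟨N, hN⟩ := eventually_atTop.1
    ((isRestricted_iff_tendsto.1 hf).eventually_lt_const (half_pos hpos))
  have e1 : ∀ᶠ ρ in 𝓝 r, ∀ j ∈ Finset.range N,
      ‖PowerSeries.coeff j f‖ * ρ ^ j ≤ ‖PowerSeries.coeff k f‖ * ρ ^ k := by
    rw [Filter.eventually_all_finset]
    intro j _
    rcases lt_trichotomy j k with h | rfl | h
    · exact ((hcont j).tendsto r).eventually_lt ((hcont k).tendsto r) (h1.2 j h) |>.mono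
        fun _ => le_of_lt
    · exact Eventually.of_forall fun _ => le_rfl
    · exact ((hcont j).tendsto r).eventually_lt ((hcont k).tendsto r) (h2.2 j h) |>.mono
        fun _ => le_of_lt
  filter_upwards [e1, eventually_gt_nhds hr, eventually_lt_nhds hrs,
    ((hcont k).tendsto r).eventually_const_lt (half_lt_self hpos)] with ρ h1' h0 hs hk
  refine ⟨h1.1.1, fun j => ?_⟩
  by_cases hj : j < N
  · exact h1' j (Finset.mem_range.2 hj)
  · refine le_trans ?_ ((hN j (not_lt.1 hj)).le.trans hk.le)
    gcongr

end Dominance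

/-! ### Dominant indices of products -/

section Ultrametric

variable {F : Type*} [NormedField F] [IsUltrametricDist F]

lemma norm_sum_lt_of_forall_lt {ι : Type*} (s : Finset ι) (u : ι → F) {C : ℝ} (hC : 0 < C)
    (h : ∀ i ∈ s, ‖u i‖ < C) : ‖∑ i ∈ s, u i‖ < C := by
  classical
  induction s using Finset.induction_on with
  | empty => simpa
  | insert a s ha ih =>
    rw [Finset.sum_insert ha]
    refine (IsUltrametricDist.norm_add_le_max _ _).trans_lt (max_lt (h a (by simp)) (ih ?_))
    exact fun i hi => h i (by simp [hi])

lemma norm_eq_of_norm_sub_lt {x y : F} (h : ‖x - y‖ < ‖y‖) : ‖x‖ = ‖y‖ := by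
  have := IsUltrametricDist.norm_add_eq_max_of_norm_ne_norm h.ne
  rwa [sub_add_cancel, max_eq_right h.le] at this

lemma norm_coeff_mul_le {r C : ℝ} (hr : 0 < r) (hC : 0 ≤ C) {f g : F⟦X⟧} {n : ℕ}
    (h : ∀ a b, a + b = n →
      (‖PowerSeries.coeff a f‖ * r ^ a) * (‖PowerSeries.coeff b g‖ * r ^ b) ≤ C) :
    ‖PowerSeries.coeff n (f * g)‖ * r ^ n ≤ C := by
  rw [← le_div_iff₀ (by positivity), PowerSeries.coeff_mul]
  refine IsUltrametricDist.norm_sum_le_of_forall_le_of_nonneg (by positivity) fun x hx => ?_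
  rw [Finset.HasAntidiagonal.mem_antidiagonal] at hx
  rw [le_div_iff₀ (by positivity), norm_mul, ← hx, pow_add]
  exact (le_of_eq (by ring)).trans (h x.1 x.2 hx)

lemma norm_coeff_mul_lt {r C : ℝ} (hr : 0 < r) (hC : 0 < C) {f g : F⟦X⟧} {n : ℕ}
    (h : ∀ a b, a + b = n →
      (‖PowerSeries.coeff a f‖ * r ^ a) * (‖PowerSeries.coeff b g‖ * r ^ b) < C) :
    ‖PowerSeries.coeff n (f * g)‖ * r ^ n < C := by
  rw [← lt_div_iff₀ (by positivity), PowerSeries.coeff_mul]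
  refine norm_sum_lt_of_forall_lt _ _ (by positivity) fun x hx => ?_
  rw [Finset.HasAntidiagonal.mem_antidiagonal] at hx
  rw [lt_div_iff₀ (by positivity), norm_mul, ← hx, pow_add]
  exact (le_of_eq (by ring)).trans_lt (h x.1 x.2 hx)

/-- If the product of the terms of indices `i` and `j` exceeds all other products of terms of the
same total index, then it gives the norm of the term of index `i + j` of the product. -/
lemma norm_coeff_mul_eq {r : ℝ} (hr : 0 < r) {f g : F⟦X⟧} {i j : ℕ}
    (hi : PowerSeries.coeff i f ≠ 0) (hj : PowerSeries.coeff j g ≠ 0)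
    (h : ∀ a b, a + b = i + j → a ≠ i →
      (‖PowerSeries.coeff a f‖ * r ^ a) * (‖PowerSeries.coeff b g‖ * r ^ b) <
      (‖PowerSeries.coeff i f‖ * r ^ i) * (‖PowerSeries.coeff j g‖ * r ^ j)) :
    ‖PowerSeries.coeff (i + j) (f * g)‖ * r ^ (i + j) =
      (‖PowerSeries.coeff i f‖ * r ^ i) * (‖PowerSeries.coeff j g‖ * r ^ j) := by
  classical
  have key : ‖PowerSeries.coeff (i + j) (f * g)‖ =
      ‖PowerSeries.coeff i f * PowerSeries.coeff j g‖ := by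
    apply norm_eq_of_norm_sub_lt
    rw [PowerSeries.coeff_mul, ← Finset.sum_erase_add _ _
      (Finset.HasAntidiagonal.mem_antidiagonal.2
        (rfl : ((i, j) : ℕ × ℕ).1 + (i, j).2 = i + j)), add_sub_cancel_right]
    refine norm_sum_lt_of_forall_lt _ _ (norm_pos_iff.2 (mul_ne_zero hi hj)) fun x hx => ?_
    rw [Finset.mem_erase, Finset.HasAntidiagonal.mem_antidiagonal] at hx
    have hne : x.1 ≠ i := fun he => hx.1 (Prod.ext he (by have := hx.2; simp; omega))
    have h' := h x.1 x.2 hx.2 hne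
    have e1 : (‖PowerSeries.coeff x.1 f‖ * r ^ x.1) * (‖PowerSeries.coeff x.2 g‖ * r ^ x.2) =
      ‖PowerSeries.coeff x.1 f * PowerSeries.coeff x.2 g‖ * r ^ (i + j) := by
      rw [norm_mul, ← hx.2, pow_add]; ring
    have e2 : (‖PowerSeries.coeff i f‖ * r ^ i) * (‖PowerSeries.coeff j g‖ * r ^ j) =
      ‖PowerSeries.coeff i f * PowerSeries.coeff j g‖ * r ^ (i + j) := by
      rw [norm_mul, pow_add]; ring
    rw [e1, e2] at h'
    exact lt_of_mul_lt_mul_right h' (by positivity)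
  rw [key, norm_mul, pow_add]
  ring

/-- A refinement of the multiplicativity of the Gauss norm: a pair (a, b) ≠ (i, j) with a + b ≤ i +
j has a < i or b < j, so its product is strictly smaller and nothing can cancel the (i, j)
contribution. -/
lemma FirstDominant.mul {r : ℝ} (hr : 0 < r) {f g : F⟦X⟧} {i j : ℕ} (hf : FirstDominant r f i)
    (hg : FirstDominant r g j) : FirstDominant r (f * g) (i + j) := by
  have hfp := term_pos hr hf.1.1
  have hgp := term_pos hr hg.1.1
  have hlt : ∀ a b, (a < i ∨ b < j) →
      (‖PowerSeries.coeff a f‖ * r ^ a) * (‖PowerSeries.coeff b g‖ * r ^ b) <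
      (‖PowerSeries.coeff i f‖ * r ^ i) * (‖PowerSeries.coeff j g‖ * r ^ j) := by
    rintro a b (h | h)
    · exact mul_lt_mul_of_lt_of_le_of_nonneg_of_pos (hf.2 a h) (hg.1.2 b)
          (term_nonneg hr f a) hgp
    · exact mul_lt_mul_of_le_of_lt_of_nonneg_of_pos (hf.1.2 a) (hg.2 b h)
          (term_nonneg hr g b) hfp
  have heq := norm_coeff_mul_eq hr hf.1.1 hg.1.1 fun a b hab ha => hlt a b (by omega)
  refine ⟨⟨fun h0 => ?_, fun n => ?_⟩, fun n hn => ?_⟩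
  · rw [h0, norm_zero, zero_mul] at heq
    exact (mul_pos hfp hgp).ne heq
  · rw [heq]
    exact norm_coeff_mul_le hr (by positivity) fun a b _ =>
      mul_le_mul (hf.1.2 a) (hg.1.2 b) (term_nonneg hr g b) hfp.le
  · rw [heq]
    exact norm_coeff_mul_lt hr (by positivity) fun a b hab => hlt a b (by omega)

lemma LastDominant.mul {r : ℝ} (hr : 0 < r) {f g : F⟦X⟧} {i j : ℕ} (hf : LastDominant r f i)
    (hg : LastDominant r g j) : LastDominant r (f * g) (i + j) := by
  have hfp := term_pos hr hf.1.1
  have hgp := term_pos hr hg.1.1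
  have hlt : ∀ a b, (i < a ∨ j < b) →
      (‖PowerSeries.coeff a f‖ * r ^ a) * (‖PowerSeries.coeff b g‖ * r ^ b) <
      (‖PowerSeries.coeff i f‖ * r ^ i) * (‖PowerSeries.coeff j g‖ * r ^ j) := by
    rintro a b (h | h)
    · exact mul_lt_mul_of_lt_of_le_of_nonneg_of_pos (hf.2 a h) (hg.1.2 b)
          (term_nonneg hr f a) hgp
    · exact mul_lt_mul_of_le_of_lt_of_nonneg_of_pos (hf.1.2 a) (hg.2 b h)
          (term_nonneg hr g b) hfp
  have heq := norm_coeff_mul_eq hr hf.1.1 hg.1.1 fun a b hab ha => hlt a b (by omega)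
  refine ⟨⟨fun h0 => ?_, fun n => ?_⟩, fun n hn => ?_⟩
  · rw [h0, norm_zero, zero_mul] at heq
    exact (mul_pos hfp hgp).ne heq
  · rw [heq]
    exact norm_coeff_mul_le hr (by positivity) fun a b _ =>
      mul_le_mul (hf.1.2 a) (hg.1.2 b) (term_nonneg hr g b) hfp.le
  · rw [heq]
    exact norm_coeff_mul_lt hr (by positivity) fun a b hab => hlt a b (by omega)

/-- Restrictedness at a larger radius descends to a cofactor of a series whose last dominant index
bounds its support. -/
lemma PowerSeries.IsRestricted.of_mul {r R : ℝ} (hr : 0 < r) (hrR : r ≤ R) {P ψ : F⟦X⟧} {d : ℕ}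
    (hP : LastDominant r P d) (hPd : ∀ n, d < n → PowerSeries.coeff n P = 0)
    (hψ : PowerSeries.IsRestricted r ψ) (h : PowerSeries.IsRestricted R (P * ψ)) :
    PowerSeries.IsRestricted R ψ := by
  have hR : 0 < R := hr.trans_le hrR
  have hPp := term_pos hr hP.1.1
  have key : ∀ m, PowerSeries.coeff m ψ ≠ 0 → ∃ n, m ≤ n ∧
      (‖PowerSeries.coeff d P‖ * r ^ d) * (‖PowerSeries.coeff m ψ‖ * r ^ m) ≤
        ‖PowerSeries.coeff n (P * ψ)‖ * r ^ n := by
    intro m hm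
    -- The maximum is taken over indices ≥ m only. In degree d + n of the product, a pair (a, b)
    -- with a < d has b > n, where ψ is strictly smaller, and a > d contributes nothing; so the pair
    -- (d, n) stands alone.
    obtain ⟨n, hmn, h1, h2⟩ := exists_last_max (isRestricted_iff_tendsto.1 hψ) (Ici m)
      (mem_Ici.2 le_rfl) (term_pos hr hm)
    have hnp : 0 < ‖PowerSeries.coeff n ψ‖ * r ^ n :=
      (term_pos hr hm).trans_le (h1 m (mem_Ici.2 le_rfl))
    have hn0 : PowerSeries.coeff n ψ ≠ 0 := by
      intro h0
      rw [h0, norm_zero, zero_mul] at hnp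
      exact lt_irrefl _ hnp
    have heq := norm_coeff_mul_eq hr hP.1.1 hn0 fun a b hab ha => by
      rcases lt_or_gt_of_ne ha with ha | ha
      · exact mul_lt_mul_of_le_of_lt_of_nonneg_of_pos (hP.1.2 a)
          (h2 b (mem_Ici.2 (by have := mem_Ici.1 hmn; omega)) (by omega)) (term_nonneg hr ψ b) hPp
      · rw [hPd a ha, norm_zero, zero_mul, zero_mul]
        exact mul_pos hPp hnp
    refine ⟨d + n, le_add_of_le_right hmn, heq ▸ ?_⟩
    exact mul_le_mul_of_nonneg_left (h1 m (mem_Ici.2 le_rfl)) hPp.le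
  rw [isRestricted_iff_tendsto] at h ⊢
  rw [Metric.tendsto_atTop] at h ⊢
  intro ε hε
  obtain ⟨N, hN⟩ := h ((‖PowerSeries.coeff d P‖ * r ^ d) * ε) (by positivity)
  refine ⟨N, fun m hm => ?_⟩
  rw [Real.dist_0_eq_abs, abs_of_nonneg (term_nonneg hR _ _)]
  by_cases hm0 : PowerSeries.coeff m ψ = 0
  · simpa [hm0]
  obtain ⟨n, hmn, hle⟩ := key m hm0
  have h3 := hN n (hm.trans hmn)
  rw [Real.dist_0_eq_abs, abs_of_nonneg (term_nonneg hR _ _)] at h3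
  refine lt_of_mul_lt_mul_left (lt_of_le_of_lt ?_ h3) hPp.le
  have e1 : ∀ x : ℝ, ∀ n : ℕ, x * R ^ n = x * r ^ n * (R / r) ^ n := fun x n => by
    rw [div_pow]; field_simp
  -- Passing from r to R multiplies the terms by (R / r)^m and (R / r)^n, and m ≤ n preserves the
  -- inequality.
  rw [e1 _ m, e1 _ n, ← mul_assoc]
  refine mul_le_mul hle (pow_le_pow_right₀ ((one_le_div hr).2 hrR) hmn) (by positivity)
    (term_nonneg hr _ _)

end Ultrametric

/-! ### The Legendre transform and the edges given by dominant indices -/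

section Tropical

variable {F : Type*} [NormedField F] {φ : F⟦X⟧}

lemma enorm_mul_ofReal_pow (c : F) {r : ℝ} (hr : 0 ≤ r) (n : ℕ) :
    ‖c‖ₑ * ENNReal.ofReal r ^ n = ENNReal.ofReal (‖c‖ * r ^ n) := by
  rw [ENNReal.ofReal_mul (norm_nonneg _), ENNReal.ofReal_pow hr, ofReal_norm]

lemma log_ofReal_term {c : F} (hc : c ≠ 0) (x : ℝ) (n : ℕ) :
    ENNReal.log (ENNReal.ofReal (‖c‖ * Real.exp x ^ n)) =
      ((Real.log ‖c‖ + n * x : ℝ) : EReal) := by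
  have h : 0 < ‖c‖ := norm_pos_iff.2 hc
  rw [ENNReal.log_ofReal_of_pos (by positivity), Real.log_mul h.ne' (by positivity),
    Real.log_pow, Real.log_exp]

lemma le_tropical {n : ℕ} (hn : PowerSeries.coeff n φ ≠ 0) (x : ℝ) :
    ((Real.log ‖PowerSeries.coeff n φ‖ + n * x : ℝ) : EReal) ≤ tropical φ x := by
  rw [← log_ofReal_term hn, tropical, supNorm, ENNReal.log_le_log_iff,
    ← enorm_mul_ofReal_pow _ (Real.exp_pos x).le]
  exact le_iSup (fun n : ℕ => ‖PowerSeries.coeff n φ‖ₑ * ENNReal.ofReal (Real.exp x) ^ n) n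

lemma DominantAt.tropical_eq {r : ℝ} (hr : 0 < r) {i : ℕ} (h : DominantAt r φ i) :
    tropical φ (Real.log r) =
      ((Real.log ‖PowerSeries.coeff i φ‖ + i * Real.log r : ℝ) : EReal) := by
  refine le_antisymm ?_ (le_tropical h.1 _)
  rw [← log_ofReal_term h.1, tropical, supNorm, ENNReal.log_le_log_iff, Real.exp_log hr]
  refine iSup_le fun n => ?_
  rw [enorm_mul_ofReal_pow _ hr.le]
  exact ENNReal.ofReal_le_ofReal (h.2 n)

lemma coe_sub_le_coe_iff (a q : ℝ) (T : EReal) :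
    (a : EReal) - T ≤ q ↔ ((a - q : ℝ) : EReal) ≤ T := by
  induction T with
  | bot => simpa using (EReal.coe_ne_bot (a - q))
  | top => simp
  | coe T =>
    norm_cast
    constructor <;> intro h <;> linarith

/-- Upper bounds of ν at t are affine minorants of τ of slope t; in this form infinite values of τ
need no separate treatment. -/
lemma newtonPolygon_le_iff (t q : ℝ) :
    newtonPolygon φ t ≤ q ↔ ∀ x : ℝ, ((x * t - q : ℝ) : EReal) ≤ tropical φ x := by
  rw [newtonPolygon, iSup_le_iff]
  simp_rw [coe_sub_le_coe_iff]

lemma DominantAt.le_newtonPolygon {r : ℝ} (hr : 0 < r) {i : ℕ} (h : DominantAt r φ i) (t : ℝ) :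
    ((Real.log r * t - (Real.log ‖PowerSeries.coeff i φ‖ + i * Real.log r) : ℝ) : EReal) ≤
      newtonPolygon φ t := by
  refine le_trans ?_ (le_iSup _ (Real.log r))
  rw [h.tropical_eq hr]
  norm_cast

/-- The supremum is attained at x = log r: the line of slope t touching τ there lies below the
monomial i on the left, because i ≤ t, and below τ on the right by `hx`. -/
lemma DominantAt.newtonPolygon_eq_of_le {r : ℝ} (hr : 0 < r) {i : ℕ} (h : DominantAt r φ i)
    {t : ℝ} (hit : (i : ℝ) ≤ t)
    (hx : ∀ x, Real.log r < x →
      ((Real.log ‖PowerSeries.coeff i φ‖ + i * Real.log r + t * (x - Real.log r) : ℝ) : EReal) ≤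
        tropical φ x) :
    newtonPolygon φ t =
      ((Real.log r * t - (Real.log ‖PowerSeries.coeff i φ‖ + i * Real.log r) : ℝ) : EReal) := by
  refine le_antisymm ?_ (h.le_newtonPolygon hr t)
  rw [newtonPolygon_le_iff]
  intro x
  rcases lt_or_ge (Real.log r) x with h' | h'
  · refine le_trans (le_of_eq ?_) (hx x h')
    norm_cast
    ring
  · refine le_trans ?_ (le_tropical h.1 x)
    rw [EReal.coe_le_coe_iff]
    nlinarith

lemma DominantAt.newtonPolygon_eq {r : ℝ} (hr : 0 < r) {i j : ℕ} (hi : DominantAt r φ i)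
    (hj : DominantAt r φ j) {t : ℝ} (hit : (i : ℝ) ≤ t) (htj : t ≤ j) :
    newtonPolygon φ t =
      ((Real.log r * t - (Real.log ‖PowerSeries.coeff i φ‖ + i * Real.log r) : ℝ) : EReal) := by
  refine hi.newtonPolygon_eq_of_le hr hit fun x hx => le_trans ?_ (le_tropical hj.1 x)
  have h1 := (hi.tropical_eq hr).symm.trans (hj.tropical_eq hr)
  rw [EReal.coe_eq_coe_iff] at h1
  rw [EReal.coe_le_coe_iff]
  nlinarith

lemma DominantAt.newtonPolygon_natCast {r : ℝ} (hr : 0 < r) {i : ℕ} (h : DominantAt r φ i) :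
    newtonPolygon φ i = ((-Real.log ‖PowerSeries.coeff i φ‖ : ℝ) : EReal) := by
  rw [h.newtonPolygon_eq hr h le_rfl le_rfl]
  norm_cast
  ring

/-- If `r` is a radius of dominance of `k`, then `ν` grows with slope at least `log r` to the
right of `k`, and at most `log r` to the left of `k`. -/
lemma DominantAt.newtonPolygon_le_sub {r : ℝ} (hr : 0 < r) {k : ℕ} (h : DominantAt r φ k)
    {t t' q : ℝ} (ht : (k ≤ t ∧ t ≤ t') ∨ (t' ≤ t ∧ t ≤ k))
    (hq : newtonPolygon φ t' ≤ (q : EReal)) :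
    newtonPolygon φ t ≤ ((q - Real.log r * (t' - t) : ℝ) : EReal) := by
  rw [newtonPolygon_le_iff] at hq ⊢
  have hr' := hq (Real.log r)
  rw [h.tropical_eq hr, EReal.coe_le_coe_iff] at hr'
  intro y
  -- If y - log r and t' - t have the same sign, the bound at t' applies at y; otherwise it is used
  -- at log r and continued along the monomial k.
  have h1 : ((y * t - (q - Real.log r * (t' - t)) : ℝ) : EReal) ≤ ((y * t' - q : ℝ) : EReal) ∨
      y * t - (q - Real.log r * (t' - t)) ≤
        Real.log ‖PowerSeries.coeff k φ‖ + k * y := by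
    rw [EReal.coe_le_coe_iff]
    rcases le_total (Real.log r) y with hy | hy <;> rcases ht with ⟨h2, h3⟩ | ⟨h2, h3⟩
    · left; nlinarith
    · right; nlinarith
    · right; nlinarith
    · left; nlinarith
  rcases h1 with h1 | h1
  · exact h1.trans (hq y)
  · exact (EReal.coe_le_coe_iff.2 h1).trans (le_tropical h.1 y)

lemma HasSlopeOn.mono {f : ℝ → EReal} {μ a b a' b' : ℝ} (h : HasSlopeOn f μ a b) (ha : a ≤ a')
    (hab : a' < b') (hb : b' ≤ b) : HasSlopeOn f μ a' b' := by
  obtain ⟨-, q, hq⟩ := h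
  exact ⟨hab, q, fun t ht => hq t ⟨ha.trans ht.1, ht.2.trans hb⟩⟩

lemma HasSlopeOn.trans {f : ℝ → EReal} {μ a b c : ℝ} (h : HasSlopeOn f μ a b)
    (h' : HasSlopeOn f μ b c) : HasSlopeOn f μ a c := by
  obtain ⟨hab, q, hq⟩ := h
  obtain ⟨hbc, q', hq'⟩ := h'
  refine ⟨hab.trans hbc, q, fun t ht => ?_⟩
  have h1 := (hq b ⟨hab.le, le_rfl⟩).symm.trans (hq' b ⟨le_rfl, hbc.le⟩)
  rw [EReal.coe_eq_coe_iff] at h1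
  rcases le_total t b with h | h
  · exact hq t ⟨ht.1, h⟩
  · rw [hq' t ⟨h, ht.2⟩, EReal.coe_eq_coe_iff]
    linarith

/-- Two dominant indices at radius `r` bound a segment of slope `log r`. -/
lemma DominantAt.hasSlopeOn {r : ℝ} (hr : 0 < r) {i j : ℕ} (hi : DominantAt r φ i)
    (hj : DominantAt r φ j) (hij : i < j) :
    HasSlopeOn (newtonPolygon φ) (Real.log r) i j := by
  refine ⟨by exact_mod_cast hij, -(Real.log ‖PowerSeries.coeff i φ‖ + i * Real.log r),
    fun t ht => ?_⟩
  rw [hi.newtonPolygon_eq hr hj ht.1 ht.2, sub_eq_add_neg]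

/-- If `k` is dominant at two radii `r₁ < s < r₂`, then `log s` is not a slope. -/
lemma not_isSlope_of_dominantAt {r₁ r₂ s : ℝ} (hr : 0 < r₁) (h1 : r₁ < s) (h2 : s < r₂) {k : ℕ}
    (hk₁ : DominantAt r₁ φ k) (hk₂ : DominantAt r₂ φ k) :
    ¬ IsSlope (newtonPolygon φ) (Real.log s) := by
  rintro ⟨a, b, h⟩
  have hs : 0 < s := hr.trans h1
  have l1 := Real.log_lt_log hr h1
  have l2 := Real.log_lt_log hs h2
  -- An edge reaching beyond k would have slope at least log r₂ there, and an edge to the left of k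
  -- slope at most log r₁.
  rcases lt_or_ge (k : ℝ) b with hb | hb
  · obtain ⟨hab, q, hq⟩ := h.mono (le_max_left a (k : ℝ)) (max_lt h.1 hb) le_rfl
    have := hk₂.newtonPolygon_le_sub (hs.trans h2) (Or.inl ⟨le_max_right a (k : ℝ), hab.le⟩)
      (hq b ⟨hab.le, le_rfl⟩).le
    rw [hq _ ⟨le_rfl, hab.le⟩, EReal.coe_le_coe_iff] at this
    nlinarith
  · obtain ⟨hab, q, hq⟩ := h
    have := hk₁.newtonPolygon_le_sub hr (Or.inr ⟨hab.le, hb⟩) (hq a ⟨le_rfl, hab.le⟩).le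
    rw [hq _ ⟨hab.le, le_rfl⟩, EReal.coe_le_coe_iff] at this
    nlinarith

lemma not_isSlope_of_firstDominant_lastDominant {r R : ℝ} (hr : 0 < r) (hrR : r < R) {k : ℕ}
    (hf : PowerSeries.IsRestricted R φ) (h1 : FirstDominant r φ k) (h2 : LastDominant r φ k) :
    ¬ IsSlope (newtonPolygon φ) (Real.log r) := by
  obtain ⟨ε, hε, h⟩ := Metric.eventually_nhds_iff.1 (eventually_dominantAt hr hrR hf h1 h2)
  set δ := min (ε / 2) (r / 2) with hδ
  have hδ0 : 0 < δ := lt_min (by linarith) (by linarith)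
  have hδ1 : δ < ε := (min_le_left _ _).trans_lt (by linarith)
  have hδ2 : δ < r := (min_le_right _ _).trans_lt (by linarith)
  refine not_isSlope_of_dominantAt (r₁ := r - δ) (r₂ := r + δ) (by linarith) (by linarith)
    (by linarith) (h ?_) (h ?_)
  · rw [Real.dist_eq, sub_sub_cancel_left, abs_neg, abs_of_pos hδ0]; exact hδ1
  · rw [Real.dist_eq, add_sub_cancel_left, abs_of_pos hδ0]; exact hδ1

end Tropical

/-! ### Critical radii and the slope of each unit interval -/

section Critical

variable {F : Type*} [NormedField F] {φ : F⟦X⟧}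

/-- `r` is the largest radius at which the indices `≤ n` contain a dominant one. -/
def IsCritical (φ : F⟦X⟧) (n : ℕ) (r : ℝ) : Prop :=
  0 < r ∧ (∃ j ≤ n, DominantAt r φ j) ∧ ∀ y, r < y → ∃ k, n < k ∧ ∀ i ≤ n,
    ‖PowerSeries.coeff i φ‖ * y ^ i < ‖PowerSeries.coeff k φ‖ * y ^ k

lemma exists_dominantAt_zero {R : ℝ} (hR : 0 < R) (hφ : PowerSeries.IsRestricted R φ)
    (h0 : PowerSeries.coeff 0 φ ≠ 0) : ∃ r₀ > 0, ∀ r, 0 < r → r ≤ r₀ → DominantAt r φ 0 := by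
  obtain ⟨M, hM, hb⟩ := hφ.exists_bound
  set c := ‖PowerSeries.coeff 0 φ‖ with hc
  have hc0 : 0 < c := norm_pos_iff.2 h0
  -- At radius R θ the j-th term is at most M θ^j ≤ M θ for j ≥ 1 and θ ≤ 1, so θ ≤ c / M suffices.
  refine ⟨R * min 1 (c / M), by positivity, fun r hr hrr => ⟨h0, fun j => ?_⟩⟩
  rcases Nat.eq_zero_or_pos j with rfl | hj
  · exact le_rfl
  have h1 : (min 1 (c / M)) ^ j ≤ c / M :=
    (pow_le_of_le_one (by positivity) (min_le_left _ _) hj.ne').trans (min_le_right _ _)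
  calc ‖PowerSeries.coeff j φ‖ * r ^ j
      ≤ ‖PowerSeries.coeff j φ‖ * (R * min 1 (c / M)) ^ j := by gcongr
    _ = (‖PowerSeries.coeff j φ‖ * R ^ j) * (min 1 (c / M)) ^ j := by rw [mul_pow]; ring
    _ ≤ M * (c / M) := mul_le_mul (hb j) h1 (by positivity) hM.le
    _ = c * r ^ 0 := by field_simp

/-- The radii at which each later term is beaten by some term of index ≤ n form a closed set. It
contains small radii because c_0 ≠ 0, and it is bounded because the monomial k eventually wins; its
supremum is the critical radius. -/
lemma exists_isCritical {R : ℝ} (hR : 0 < R) (hφ : PowerSeries.IsRestricted R φ)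
    (h0 : PowerSeries.coeff 0 φ ≠ 0) {n k : ℕ} (hnk : n < k) (hk : PowerSeries.coeff k φ ≠ 0) :
    ∃ r, IsCritical φ n r := by
  set A : Set ℝ := Ici 0 ∩ ⋂ k ∈ Ioi n, ⋃ i ∈ Finset.range (n + 1),
    {r | ‖PowerSeries.coeff k φ‖ * r ^ k ≤ ‖PowerSeries.coeff i φ‖ * r ^ i} with hA
  have hmem : ∀ r, r ∈ A ↔ 0 ≤ r ∧ ∀ k, n < k → ∃ i ≤ n,
      ‖PowerSeries.coeff k φ‖ * r ^ k ≤ ‖PowerSeries.coeff i φ‖ * r ^ i := by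
    intro r
    simp [hA]
  have hcl : IsClosed A := by
    refine isClosed_Ici.inter (isClosed_biInter fun k _ => ?_)
    refine Set.Finite.isClosed_biUnion (Finset.finite_toSet _) fun i _ => ?_
    exact isClosed_le (by fun_prop) (by fun_prop)
  obtain ⟨r₀, hr₀, hdom⟩ := exists_dominantAt_zero hR hφ h0
  have hr₀A : r₀ ∈ A := (hmem r₀).2 ⟨hr₀.le, fun k _ => ⟨0, Nat.zero_le _,
    (hdom r₀ hr₀ le_rfl).2 k⟩⟩
  have hev : ∀ᶠ y : ℝ in atTop, ∀ i ∈ Finset.range (n + 1),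
      ‖PowerSeries.coeff i φ‖ * y ^ i < ‖PowerSeries.coeff k φ‖ * y ^ k := by
    rw [Filter.eventually_all_finset]
    intro i hi
    have hik : i < k := by rw [Finset.mem_range] at hi; omega
    have hkp : 0 < ‖PowerSeries.coeff k φ‖ := norm_pos_iff.2 hk
    filter_upwards [eventually_ge_atTop (1 : ℝ),
      (tendsto_id.const_mul_atTop hkp).eventually_gt_atTop
      ‖PowerSeries.coeff i φ‖] with y hy1 hy
    obtain ⟨m, rfl⟩ : ∃ m, k = i + 1 + m := ⟨k - (i + 1), by omega⟩
    have hp : 0 < y ^ i := by positivity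
    calc ‖PowerSeries.coeff i φ‖ * y ^ i < (‖PowerSeries.coeff (i + 1 + m) φ‖ * y) * y ^ i :=
          mul_lt_mul_of_pos_right hy hp
      _ = ‖PowerSeries.coeff (i + 1 + m) φ‖ * y ^ (i + 1) := by ring
      _ ≤ ‖PowerSeries.coeff (i + 1 + m) φ‖ * y ^ (i + 1 + m) := by
          exact mul_le_mul_of_nonneg_left (pow_le_pow_right₀ hy1 (by omega)) hkp.le
  obtain ⟨Y, hY⟩ := eventually_atTop.1 hev
  have hbdd : BddAbove A := by
    refine ⟨Y, fun r hr => ?_⟩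
    by_contra hlt
    obtain ⟨i, hi, hle⟩ := ((hmem r).1 hr).2 k hnk
    exact absurd (hY r (not_le.1 hlt).le i (by simp; omega)) (not_lt.2 hle)
  have hs : sSup A ∈ A := hcl.csSup_mem ⟨r₀, hr₀A⟩ hbdd
  have hs0 : 0 < sSup A := hr₀.trans_le (le_csSup hbdd hr₀A)
  refine ⟨sSup A, hs0, ?_, fun y hy => ?_⟩
  · obtain ⟨j, hj, hmax⟩ := (Finset.range (n + 1)).exists_max_image
      (fun i => ‖PowerSeries.coeff i φ‖ * sSup A ^ i) ⟨0, by simp⟩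
    refine ⟨j, by simpa [Nat.lt_succ_iff] using hj, fun hj0 => ?_, fun k => ?_⟩
    · have := hmax 0 (by simp)
      simp only [hj0, norm_zero, zero_mul, pow_zero, mul_one] at this
      exact h0 (norm_le_zero_iff.1 this)
    · rcases le_or_gt k n with hkn | hkn
      · exact hmax k (by simpa [Nat.lt_succ_iff] using hkn)
      · obtain ⟨i, hi, hle⟩ := ((hmem _).1 hs).2 k hkn
        exact hle.trans (hmax i (by simpa [Nat.lt_succ_iff] using hi))
  · have hyA : y ∉ A := fun h => absurd (le_csSup hbdd h) (not_le.2 hy)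
    rw [hmem] at hyA
    push Not at hyA
    exact hyA (hs0.trans hy).le

lemma IsCritical.le {n m : ℕ} {r s : ℝ} (hr : IsCritical φ n r) (hs : IsCritical φ m s)
    (hnm : n ≤ m) : r ≤ s := by
  by_contra! hlt
  obtain ⟨k, hk, h⟩ := hs.2.2 r hlt
  obtain ⟨j, hj, hdom⟩ := hr.2.1
  exact absurd (h j (hj.trans hnm)) (not_lt.2 (hdom.2 k))

/-- No index beyond n need be dominant at r itself, as on a final edge of infinite length. For z
slightly above log r, though, some k ≥ n + 1 ≥ t beats j, and from z on the monomial k rises at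
least as fast as the line of slope t; then z tends to log r. -/
lemma IsCritical.newtonPolygon_eq {n : ℕ} {r : ℝ} (h : IsCritical φ n r) {j : ℕ} (hjn : j ≤ n)
    (hj : DominantAt r φ j) {t : ℝ} (ht : t ∈ Icc (n : ℝ) (n + 1)) :
    newtonPolygon φ t =
      ((Real.log r * t - (Real.log ‖PowerSeries.coeff j φ‖ + j * Real.log r) : ℝ) : EReal) := by
  obtain ⟨hr, -, hcrit⟩ := h
  have hjn' : (j : ℝ) ≤ n := by exact_mod_cast hjn
  refine hj.newtonPolygon_eq_of_le hr (hjn'.trans ht.1) fun x hx => ?_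
  have hlim : Tendsto (fun z : ℝ =>
      ((Real.log ‖PowerSeries.coeff j φ‖ + j * Real.log r + t * (x - z) : ℝ) : EReal))
      (𝓝[>] (Real.log r))
      (𝓝 ((Real.log ‖PowerSeries.coeff j φ‖ + j * Real.log r + t * (x - Real.log r) : ℝ) :
        EReal)) := by
    apply Tendsto.mono_left _ nhdsWithin_le_nhds
    exact ((continuous_coe_real_ereal).comp (by fun_prop :
      Continuous fun z : ℝ => Real.log ‖PowerSeries.coeff j φ‖ + j * Real.log r + t * (x - z)))
      |>.tendsto
      (Real.log r)
  refine le_of_tendsto hlim ?_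
  filter_upwards [Ioo_mem_nhdsGT hx] with z hz
  obtain ⟨k, hk, hlt⟩ := hcrit (Real.exp z) ((Real.log_lt_iff_lt_exp hr).1 hz.1)
  have h1 := hlt j hjn
  have hk0 : PowerSeries.coeff k φ ≠ 0 := by
    intro h0
    rw [h0, norm_zero, zero_mul] at h1
    exact absurd (term_nonneg (Real.exp_pos z) φ j) (not_le.2 h1)
  have h2 : Real.log ‖PowerSeries.coeff j φ‖ + j * z <
      Real.log ‖PowerSeries.coeff k φ‖ + k * z := by
    have := Real.log_lt_log (term_pos (Real.exp_pos z) hj.1) h1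
    rwa [Real.log_mul (norm_ne_zero_iff.2 hj.1) (by positivity),
      Real.log_mul (norm_ne_zero_iff.2 hk0) (by positivity), Real.log_pow, Real.log_pow,
      Real.log_exp] at this
  refine le_trans ?_ (le_tropical hk0 x)
  rw [EReal.coe_le_coe_iff]
  have hk' : (n : ℝ) + 1 ≤ k := by exact_mod_cast hk
  have hj0 : (0 : ℝ) ≤ j := Nat.cast_nonneg j
  have htk : t ≤ k := ht.2.trans hk'
  nlinarith [mul_le_mul_of_nonneg_right htk (sub_nonneg.2 hz.2.le),
    mul_le_mul_of_nonneg_left hz.1.le hj0]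

lemma IsCritical.hasSlopeOn {n : ℕ} {r : ℝ} (h : IsCritical φ n r) :
    HasSlopeOn (newtonPolygon φ) (Real.log r) n (n + 1) := by
  obtain ⟨j, hjn, hj⟩ := h.2.1
  refine ⟨by linarith, -(Real.log ‖PowerSeries.coeff j φ‖ + j * Real.log r), fun t ht => ?_⟩
  rw [h.newtonPolygon_eq hjn hj ht, sub_eq_add_neg]

end Critical

/-! ### Shape of the polygon and its break points -/

section BreakPoints

lemma HasSlopeOn.not_isBreakPoint {f : ℝ → EReal} {μ a b t : ℝ} (h : HasSlopeOn f μ a b)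
    (ht : t ∈ Ioo a b) : ¬ IsBreakPoint f t := by
  rintro ⟨-, -, hd⟩
  obtain ⟨-, q, hq⟩ := h
  refine hd ⟨fun s => μ * s + q, by fun_prop, ?_⟩
  filter_upwards [Ioo_mem_nhds ht.1 ht.2] with s hs
  exact hq s (Ioo_subset_Icc_self hs)

/-- The two slopes are the one-sided derivatives at t of a function differentiable there. -/
lemma HasSlopeOn.eq_of_not_isBreakPoint {f : ℝ → EReal} {μ μ' a t b : ℝ} (h : HasSlopeOn f μ a t)
    (h' : HasSlopeOn f μ' t b) (ht : ¬ IsBreakPoint f t) : μ = μ' := by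
  obtain ⟨hat, q, hq⟩ := h
  obtain ⟨htb, q', hq'⟩ := h'
  have hft : f t = ((μ * t + q : ℝ) : EReal) := hq t ⟨hat.le, le_rfl⟩
  have hd : ERealDifferentiableAt f t := by
    by_contra hd
    exact ht ⟨by rw [hft]; exact EReal.coe_ne_bot _, by rw [hft]; exact EReal.coe_ne_top _, hd⟩
  obtain ⟨g, hg, hfg⟩ := hd
  have hgt := hfg.self_of_nhds
  have e1 : HasDerivWithinAt g μ (Iic t) t := by
    have : HasDerivWithinAt (fun s => μ * s + q) μ (Iic t) t := by
      simpa using (((hasDerivAt_id t).const_mul μ).add_const q).hasDerivWithinAt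
    refine this.congr_of_eventuallyEq ?_ ?_
    · filter_upwards [mem_nhdsWithin_of_mem_nhds hfg, Icc_mem_nhdsLE hat] with s hs hs'
      exact EReal.coe_eq_coe_iff.1 (hs.symm.trans (hq s hs'))
    · exact EReal.coe_eq_coe_iff.1 (hgt.symm.trans hft)
  have e2 : HasDerivWithinAt g μ' (Ici t) t := by
    have : HasDerivWithinAt (fun s => μ' * s + q') μ' (Ici t) t := by
      simpa using (((hasDerivAt_id t).const_mul μ').add_const q').hasDerivWithinAt
    refine this.congr_of_eventuallyEq ?_ ?_
    · filter_upwards [mem_nhdsWithin_of_mem_nhds hfg, Icc_mem_nhdsGE htb] with s hs hs'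
      exact EReal.coe_eq_coe_iff.1 (hs.symm.trans (hq' s hs'))
    · exact EReal.coe_eq_coe_iff.1 (hgt.symm.trans (hq' t ⟨le_rfl, htb.le⟩))
  have h1 := (uniqueDiffWithinAt_Iic t).eq_deriv _ e1 (hg.hasDerivAt.hasDerivWithinAt)
  have h2 := (uniqueDiffWithinAt_Ici t).eq_deriv _ e2 (hg.hasDerivAt.hasDerivWithinAt)
  rw [h1, h2]

variable {F : Type*} [NormedField F] {φ : F⟦X⟧}

/-- A series which is not a polynomial has a critical radius for every index. -/
lemma exists_isCritical_of_ne_coe {R : ℝ} (hR : 0 < R) (hφ : PowerSeries.IsRestricted R φ)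
    (hpol : ∀ p : F[X], (p : F⟦X⟧) ≠ φ) (h0 : PowerSeries.coeff 0 φ ≠ 0) (n : ℕ) :
    ∃ r, IsCritical φ n r := by
  obtain ⟨k, hk, hk0⟩ : ∃ k, n < k ∧ PowerSeries.coeff k φ ≠ 0 := by
    by_contra! h
    refine hpol (PowerSeries.trunc (n + 1) φ) (PowerSeries.ext fun m => ?_)
    rw [Polynomial.coeff_coe, PowerSeries.coeff_trunc]
    split_ifs with hm
    · rfl
    · exact (h m (by omega)).symm
  exact exists_isCritical hR hφ h0 hk hk0

lemma mem_Icc_floor {t : ℝ} (ht : 0 ≤ t) : t ∈ Icc (⌊t⌋₊ : ℝ) (⌊t⌋₊ + 1) :=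
  ⟨Nat.floor_le ht, (Nat.lt_floor_add_one t).le⟩

/-- As x → -∞ the constant term is dominant, so τ stays constant while x t → +∞. -/
lemma newtonPolygon_eq_top {R : ℝ} (hR : 0 < R) (hφ : PowerSeries.IsRestricted R φ)
    (h0 : PowerSeries.coeff 0 φ ≠ 0) {t : ℝ} (ht : t < 0) : newtonPolygon φ t = ⊤ := by
  obtain ⟨r₀, hr₀, hdom⟩ := exists_dominantAt_zero hR hφ h0
  rw [EReal.eq_top_iff_forall_lt]
  intro y
  obtain ⟨x, hx1, hx2⟩ : ∃ x, x ≤ Real.log r₀ ∧ y < x * t - Real.log ‖PowerSeries.coeff 0 φ‖ := by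
    have hlim : Tendsto (fun x : ℝ => x * t - Real.log ‖PowerSeries.coeff 0 φ‖) atBot atTop :=
      tendsto_atTop_add_const_right _ _ (tendsto_id.atBot_mul_const_of_neg ht)
    exact ((eventually_le_atBot _).and (hlim.eventually_gt_atTop y)).exists
  have hd := hdom (Real.exp x) (Real.exp_pos x) ((Real.le_log_iff_exp_le hr₀).1 hx1)
  refine lt_of_lt_of_le (EReal.coe_lt_coe_iff.2 hx2) (le_trans (le_of_eq ?_)
    (hd.le_newtonPolygon (Real.exp_pos x) t))
  simp

section Critical

variable {s : ℕ → ℝ}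

/-- A supporting line at each t ≥ 0 gives finiteness and convexity at once; its slope is the log of
the critical radius of ⌊t⌋. -/
lemma exists_support (hs : ∀ n, IsCritical φ n (s n)) {t : ℝ} (ht : 0 ≤ t) :
    ∃ μ m : ℝ, newtonPolygon φ t = ((μ * t - m : ℝ) : EReal) ∧
      ∀ u, ((μ * u - m : ℝ) : EReal) ≤ newtonPolygon φ u := by
  obtain ⟨j, hjn, hj⟩ := (hs ⌊t⌋₊).2.1
  exact ⟨_, _, (hs ⌊t⌋₊).newtonPolygon_eq hjn hj (mem_Icc_floor ht),
    hj.le_newtonPolygon (hs ⌊t⌋₊).1⟩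

lemma newtonPolygon_ne_bot_ne_top (hs : ∀ n, IsCritical φ n (s n)) {t : ℝ} (ht : 0 ≤ t) :
    newtonPolygon φ t ≠ ⊥ ∧ newtonPolygon φ t ≠ ⊤ := by
  obtain ⟨μ, m, h, -⟩ := exists_support hs ht
  rw [h]
  exact ⟨EReal.coe_ne_bot _, EReal.coe_ne_top _⟩

lemma coe_toReal_newtonPolygon (hs : ∀ n, IsCritical φ n (s n)) {t : ℝ} (ht : 0 ≤ t) :
    ((newtonPolygon φ t).toReal : EReal) = newtonPolygon φ t :=
  EReal.coe_toReal (newtonPolygon_ne_bot_ne_top hs ht).2 (newtonPolygon_ne_bot_ne_top hs ht).1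

lemma convexOn_newtonPolygon (hs : ∀ n, IsCritical φ n (s n)) :
    ConvexOn ℝ (Ici 0) (fun t => (newtonPolygon φ t).toReal) := by
  refine ⟨convex_Ici 0, fun x hx y hy a b ha hb hab => ?_⟩
  have hw : 0 ≤ a • x + b • y := by
    have := mem_Ici.1 hx
    have := mem_Ici.1 hy
    simp only [smul_eq_mul]
    positivity
  obtain ⟨μ, m, h, hle⟩ := exists_support hs hw
  have hx' := hle x
  have hy' := hle y
  rw [← coe_toReal_newtonPolygon hs hx, EReal.coe_le_coe_iff] at hx'
  rw [← coe_toReal_newtonPolygon hs hy, EReal.coe_le_coe_iff] at hy'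
  simp only [smul_eq_mul] at h ⊢
  rw [h, EReal.toReal_coe]
  have hb' : b = 1 - a := by linarith
  calc μ * (a * x + b * y) - m = a * (μ * x - m) + b * (μ * y - m) := by rw [hb']; ring
    _ ≤ _ := add_le_add (mul_le_mul_of_nonneg_left hx' ha) (mul_le_mul_of_nonneg_left hy' hb)

lemma continuousOn_newtonPolygon (hs : ∀ n, IsCritical φ n (s n)) :
    ContinuousOn (newtonPolygon φ) (Ici 0) := by
  have hg : ContinuousOn (fun t => (newtonPolygon φ t).toReal) (Ici 0) := by
    intro t ht
    rcases (mem_Ici.1 ht).eq_or_lt with rfl | ht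
    -- Convexity gives continuity only in the interior; at the endpoint 0 the first edge is used.
    · obtain ⟨h01, q, hq⟩ := (hs 0).hasSlopeOn
      simp only [Nat.cast_zero, zero_add] at h01 hq
      have hc : ContinuousWithinAt (fun t : ℝ => Real.log (s 0) * t + q) (Ici 0) 0 := by fun_prop
      refine hc.congr_of_eventuallyEq ?_ ?_
      · filter_upwards [Icc_mem_nhdsGE h01] with u hu
        rw [hq u hu, EReal.toReal_coe]
      · rw [hq 0 ⟨le_rfl, h01.le⟩, EReal.toReal_coe]
    · have := ((convexOn_newtonPolygon hs).subset Ioi_subset_Ici_self (convex_Ioi 0)).continuousOn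
        isOpen_Ioi
      exact (this.continuousAt (Ioi_mem_nhds ht)).continuousWithinAt
  exact (continuous_coe_real_ereal.comp_continuousOn hg).congr
    fun t ht => (coe_toReal_newtonPolygon hs ht).symm

lemma piecewiseAffineOnNonneg_newtonPolygon (hs : ∀ n, IsCritical φ n (s n)) :
    PiecewiseAffineOnNonneg (newtonPolygon φ) := by
  -- All natural numbers serve as subdivision points, whether or not they are break points.
  refine ⟨range ((↑) : ℕ → ℝ), fun a b => ?_, fun a b ha hab hdisj => ?_⟩
  · refine ((Set.finite_Iic ⌊b⌋₊).image ((↑) : ℕ → ℝ)).subset ?_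
    rintro _ ⟨⟨n, rfl⟩, hn⟩
    exact ⟨n, Nat.le_floor hn.2, rfl⟩
  · refine ⟨Real.log (s ⌊a⌋₊), (hs ⌊a⌋₊).hasSlopeOn.mono (Nat.floor_le ha) hab ?_⟩
    by_contra! hlt
    refine Set.disjoint_left.1 hdisj ⟨⌊a⌋₊ + 1, rfl⟩ ⟨?_, ?_⟩
    · exact_mod_cast Nat.lt_floor_add_one a
    · exact_mod_cast hlt

/-- At a break point, the slopes on both sides are different. -/
lemma IsBreakPoint.slope_lt (hs : ∀ n, IsCritical φ n (s n)) {n : ℕ}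
    (hn : IsBreakPoint (newtonPolygon φ) ((n + 1 : ℕ) : ℝ)) : s n < s (n + 1) := by
  refine lt_of_le_of_ne ((hs n).le (hs (n + 1)) n.le_succ) fun heq => ?_
  have h1 := (hs n).hasSlopeOn
  have h2 := (hs (n + 1)).hasSlopeOn
  rw [heq] at h1
  push_cast at h1 h2 hn
  exact (h1.trans h2).not_isBreakPoint ⟨by linarith, by linarith⟩ hn

/-- Break points are dominant indices at the critical radius. -/
lemma IsBreakPoint.dominantAt (hs : ∀ n, IsCritical φ n (s n)) {n : ℕ}
    (hn : IsBreakPoint (newtonPolygon φ) (n : ℝ)) : DominantAt (s n) φ n := by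
  obtain ⟨j, hjn, hj⟩ := (hs n).2.1
  rcases hjn.eq_or_lt with rfl | hlt
  · exact hj
  exfalso
  obtain ⟨m, rfl⟩ : ∃ m, n = m + 1 := ⟨n - 1, by omega⟩
  have hsl := hn.slope_lt hs
  have hlog := Real.log_lt_log (hs m).1 hsl
  -- Both adjacent edges compute ν at m + 1. As the monomial j bounds τ from below at log (s m),
  -- comparing them gives (m + 1 - j) log s (m + 1) ≤ (m + 1 - j) log s m, against `hlog` since j <
  -- m + 1.
  have h1 := (hs (m + 1)).newtonPolygon_eq hjn hj (t := ((m + 1 : ℕ) : ℝ)) ⟨le_rfl, by linarith⟩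
  obtain ⟨i, him, hi⟩ := (hs m).2.1
  have h2 := (hs m).newtonPolygon_eq him hi (t := ((m + 1 : ℕ) : ℝ))
    ⟨by push_cast; linarith, by push_cast; linarith⟩
  have h3 := (le_tropical hj.1 (Real.log (s m))).trans (hi.tropical_eq (hs m).1).le
  rw [h1, EReal.coe_eq_coe_iff] at h2
  rw [EReal.coe_le_coe_iff] at h3
  have hjm : (j : ℝ) < ((m + 1 : ℕ) : ℝ) := by exact_mod_cast hlt
  nlinarith

/-- Negative t are excluded by the infinite value, and non-integral t lie inside an edge [n, n + 1].
-/
lemma IsBreakPoint.exists_nat {R : ℝ} (hR : 0 < R) (hφ : PowerSeries.IsRestricted R φ)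
    (h0 : PowerSeries.coeff 0 φ ≠ 0) (hs : ∀ n, IsCritical φ n (s n)) {t : ℝ}
    (ht : IsBreakPoint (newtonPolygon φ) t) : ∃ n : ℕ, t = n ∧ DominantAt (s n) φ n := by
  have ht0 : 0 ≤ t := by
    by_contra! h
    exact ht.2.1 (newtonPolygon_eq_top hR hφ h0 h)
  have hn : t = ⌊t⌋₊ := by
    by_contra hne
    exact (hs ⌊t⌋₊).hasSlopeOn.not_isBreakPoint
      ⟨lt_of_le_of_ne (Nat.floor_le ht0) (Ne.symm hne), Nat.lt_floor_add_one t⟩ ht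
  refine ⟨⌊t⌋₊, hn, ?_⟩
  rw [hn] at ht
  exact ht.dominantAt hs

lemma isBreakPoint_zero {R : ℝ} (hR : 0 < R) (hφ : PowerSeries.IsRestricted R φ)
    (h0 : PowerSeries.coeff 0 φ ≠ 0) (hs : ∀ n, IsCritical φ n (s n)) :
    IsBreakPoint (newtonPolygon φ) 0 := by
  obtain ⟨h1, h2⟩ := newtonPolygon_ne_bot_ne_top hs le_rfl
  refine ⟨h1, h2, ?_⟩
  rintro ⟨g, -, hg⟩
  obtain ⟨u, hu, hu0⟩ := ((hg.filter_mono nhdsWithin_le_nhds).and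
    (self_mem_nhdsWithin : Iio (0 : ℝ) ∈ 𝓝[<] (0 : ℝ))).exists
  rw [newtonPolygon_eq_top hR hφ h0 hu0] at hu
  exact EReal.coe_ne_top _ hu.symm

lemma ConsecutiveBreakPoints.eq_of_mem (hs : ∀ n, IsCritical φ n (s n)) {k l : ℕ}
    (h : ConsecutiveBreakPoints (newtonPolygon φ) k l) {n : ℕ} (hkn : k ≤ n) (hnl : n < l) :
    s n = s k := by
  induction n, hkn using Nat.le_induction with
  | base => rfl
  | succ n hkn ih =>
    rw [← ih (by omega)]
    have h1 := (hs n).hasSlopeOn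
    have h2 := (hs (n + 1)).hasSlopeOn
    have h3 := h.2.2.2 ((n + 1 : ℕ) : ℝ) ⟨by exact_mod_cast (by omega : k < n + 1),
      by exact_mod_cast hnl⟩
    push_cast at h1 h2 h3
    exact (Real.log_injOn_pos (hs n).1 (hs (n + 1)).1 (h1.eq_of_not_isBreakPoint h2 h3)).symm

/-- On the segment between two consecutive break points `k < l`, the first and last dominant
indices are `k` and `l`. -/
lemma ConsecutiveBreakPoints.dominant (hs : ∀ n, IsCritical φ n (s n)) {k l : ℕ}
    (h : ConsecutiveBreakPoints (newtonPolygon φ) k l) :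
    FirstDominant (s k) φ k ∧ LastDominant (s k) φ l ∧ s k < s l := by
  have hkl : k < l := by exact_mod_cast h.1
  have hr := (hs k).1
  have hk : DominantAt (s k) φ k := h.2.1.dominantAt hs
  obtain ⟨m, rfl⟩ : ∃ m, l = m + 1 := ⟨l - 1, by omega⟩
  have hm : s m = s k := h.eq_of_mem hs (by omega) (by omega)
  have hlt : s k < s (m + 1) := hm ▸ h.2.2.1.slope_lt hs
  have hl : DominantAt (s k) φ (m + 1) := by
    have hl' : DominantAt (s (m + 1)) φ (m + 1) := h.2.2.1.dominantAt hs
    have e1 := hl'.newtonPolygon_natCast (hs (m + 1)).1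
    obtain ⟨j, hjm, hj⟩ := (hs m).2.1
    have e2 := (hs m).newtonPolygon_eq hjm hj (t := ((m + 1 : ℕ) : ℝ))
      ⟨by push_cast; linarith, by push_cast; linarith⟩
    rw [e1, EReal.coe_eq_coe_iff, hm] at e2
    rw [hm] at hj
    -- Since l = m + 1 is dominant at its own critical radius, ν(l) = -log |c_l|; as l also ends an
    -- edge of slope log (s k), its term attains the maximum at s k.
    have e3 : ‖PowerSeries.coeff (m + 1) φ‖ * s k ^ (m + 1) =
        ‖PowerSeries.coeff j φ‖ * s k ^ j := by
      apply Real.log_injOn_pos (term_pos hr hl'.1) (term_pos hr hj.1)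
      rw [Real.log_mul (norm_ne_zero_iff.2 hl'.1) (by positivity),
        Real.log_mul (norm_ne_zero_iff.2 hj.1) (by positivity), Real.log_pow, Real.log_pow]
      linarith
    exact ⟨hl'.1, fun i => e3 ▸ hj.2 i⟩
  -- A dominant index outside [k, l] would give a longer edge with k or l in its interior, where no
  -- break point can lie.
  refine ⟨⟨hk, fun j hj => ?_⟩, ⟨hl, fun j hj => ?_⟩, hlt⟩
  · refine lt_of_le_of_ne (hk.2 j) fun he => ?_
    have hjd : DominantAt (s k) φ j := by
      refine ⟨fun hj0 => ?_, fun i => he ▸ hk.2 i⟩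
      rw [hj0, norm_zero, zero_mul] at he
      exact (term_pos hr hk.1).ne he
    exact (hjd.hasSlopeOn hr hl (by omega)).not_isBreakPoint
      ⟨by exact_mod_cast hj, by exact_mod_cast hkl⟩ h.2.1
  · refine lt_of_le_of_ne (hl.2 j) fun he => ?_
    have hjd : DominantAt (s k) φ j := by
      refine ⟨fun hj0 => ?_, fun i => he ▸ hl.2 i⟩
      rw [hj0, norm_zero, zero_mul] at he
      exact (term_pos hr hl.1).ne he
    exact (hk.hasSlopeOn hr hjd (by omega)).not_isBreakPoint
      ⟨by exact_mod_cast hkl, by exact_mod_cast hj⟩ h.2.2.1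

end Critical

/-- At an intermediate radius ρ the terms tend to 0, hence are eventually ≤ 1, so the radius of
convergence is at least ρ > r. -/
lemma log_lt_log_convergenceRadius {r s M : ℝ} (hr : 0 < r) (hrs : r < s)
    (hb : ∀ n, ‖PowerSeries.coeff n φ‖ * s ^ n ≤ M) :
    (Real.log r : EReal) < ENNReal.log (convergenceRadius φ) := by
  obtain ⟨ρ, hrρ, hρs⟩ := exists_between hrs
  have hρ : 0 < ρ := hr.trans hrρ
  rw [← ENNReal.log_ofReal_of_pos hr, ENNReal.log_lt_log_iff]
  refine lt_of_lt_of_le ((ENNReal.ofReal_lt_ofReal_iff hρ).2 hrρ) ?_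
  rw [convergenceRadius, ENNReal.le_inv_iff_le_inv]
  refine limsup_le_of_le (by isBoundedDefault) ?_
  have hres := isRestricted_iff_tendsto.1 (isRestricted_of_bound hρ hρs hb)
  filter_upwards [hres.eventually_le_const zero_lt_one, eventually_gt_atTop 0] with n hn hn0
  have h1 : ‖PowerSeries.coeff n φ‖ₑ ≤ ((ENNReal.ofReal ρ)⁻¹) ^ (n : ℝ) := by
    rw [ENNReal.rpow_natCast, ← ENNReal.inv_pow, ENNReal.le_inv_iff_mul_le,
      enorm_mul_ofReal_pow _ hρ.le]
    exact ENNReal.ofReal_le_one.2 hn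
  have hn' : (n : ℝ) ≠ 0 := by exact_mod_cast hn0.ne'
  calc ‖PowerSeries.coeff n φ‖ₑ ^ (1 / (n : ℝ))
      ≤ (((ENNReal.ofReal ρ)⁻¹) ^ (n : ℝ)) ^ (1 / (n : ℝ)) :=
        ENNReal.rpow_le_rpow h1 (by positivity)
    _ = (ENNReal.ofReal ρ)⁻¹ := by
        rw [← ENNReal.rpow_mul, mul_one_div_cancel hn', ENNReal.rpow_one]

end BreakPoints

/-! ### Zeros and slopes -/

section Zeros

variable {F : Type*} [NormedField F] [IsUltrametricDist F] {φ : F⟦X⟧}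

/-- The absolute value of a zero is a radius with at least two dominant indices. -/
lemma isSlope_of_hasSum_zero {R : ℝ} (hφ : PowerSeries.IsRestricted R φ)
    (h0 : PowerSeries.coeff 0 φ ≠ 0) {a : F} (haR : ‖a‖ ≤ R)
    (ha : HasSum (fun n : ℕ => PowerSeries.coeff n φ * a ^ n) 0) :
    IsSlope (newtonPolygon φ) (Real.log ‖a‖) := by
  have ha0 : a ≠ 0 := by
    rintro rfl
    have := ha.unique (hasSum_single 0 fun n hn => by simp [hn])
    simp at this
    exact h0 (by simpa using this.symm)
  have hr : 0 < ‖a‖ := norm_pos_iff.2 ha0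
  have hres := hφ.of_le hr haR
  obtain ⟨j, hj⟩ := exists_lastDominant hr hres (by rintro rfl; simp at h0)
  obtain ⟨i, hi⟩ := hj.1.exists_firstDominant hr
  rcases (hi.le hj.1).lt_or_eq with hij | rfl
  · exact ⟨i, j, hi.1.hasSlopeOn hr hj.1 hij⟩
  exfalso
  obtain ⟨B, hB0, hBlt, hB⟩ := exists_lt_bound_of_tendsto_zero (isRestricted_iff_tendsto.1 hres)
    (term_pos hr hi.1.1) {n | n ≠ i} fun n hn => by
      rcases lt_or_gt_of_ne hn with h | h
      · exact hi.2 n h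
      · exact hj.2 n h
  -- With a single dominant index i, every finite sum containing i has the norm of its i-th term, so
  -- the sums cannot tend to 0.
  have hle : ∀ s : Finset ℕ, i ∈ s →
      ‖∑ n ∈ s, PowerSeries.coeff n φ * a ^ n‖ = ‖PowerSeries.coeff i φ * a ^ i‖ := by
    intro s his
    apply norm_eq_of_norm_sub_lt
    rw [← Finset.sum_erase_add _ _ his, add_sub_cancel_right]
    refine norm_sum_lt_of_forall_lt _ _ (norm_pos_iff.2 (mul_ne_zero hi.1.1 (pow_ne_zero _ ha0)))
      fun n hn => ?_
    rw [norm_mul, norm_mul, norm_pow, norm_pow]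
    exact (hB n (Finset.ne_of_mem_erase hn)).trans_lt hBlt
  have hlim : Tendsto (fun s : Finset ℕ => ‖∑ n ∈ s, PowerSeries.coeff n φ * a ^ n‖) atTop
      (𝓝 ‖PowerSeries.coeff i φ * a ^ i‖) := by
    refine tendsto_const_nhds.congr' ?_
    filter_upwards [eventually_ge_atTop ({i} : Finset ℕ)] with s hs
    exact (hle s (hs (Finset.mem_singleton_self i))).symm
  have hlim' := ha.norm
  simp only [norm_zero] at hlim'
  exact (mul_ne_zero hi.1.1 (pow_ne_zero i ha0))
    (norm_eq_zero.1 (tendsto_nhds_unique hlim hlim'))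

end Zeros

/-! ### Hensel-type factorization at a fixed radius -/

section Hensel

variable {F : Type*} [NormedField F]

/-- All the terms of `f` at radius `r` have norm at most `B`. -/
def TermBound (r : ℝ) (f : F⟦X⟧) (B : ℝ) : Prop :=
  ∀ n, ‖PowerSeries.coeff n f‖ * r ^ n ≤ B

lemma TermBound.mono {r B B' : ℝ} {f : F⟦X⟧} (h : TermBound r f B) (hB : B ≤ B') :
    TermBound r f B' := fun n => (h n).trans hB

lemma TermBound.neg {r B : ℝ} {f : F⟦X⟧} (h : TermBound r f B) : TermBound r (-f) B := fun n => by
  simpa using h n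

lemma termBound_zero {r B : ℝ} (hB : 0 ≤ B) : TermBound r (0 : F⟦X⟧) B := fun n => by simpa

lemma termBound_X_pow {r : ℝ} (hr : 0 < r) (n : ℕ) :
    TermBound r (PowerSeries.X ^ n : F⟦X⟧) (r ^ n) := by
  intro m
  rw [PowerSeries.coeff_X_pow]
  split_ifs with h
  · simp [h]
  · simp [hr.le]

lemma TermBound.C_mul {r B : ℝ} {f : F⟦X⟧} (h : TermBound r f B) (c : F) :
    TermBound r (PowerSeries.C c * f) (‖c‖ * B) := fun n => by
  rw [PowerSeries.coeff_C_mul, norm_mul, mul_assoc]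
  exact mul_le_mul_of_nonneg_left (h n) (norm_nonneg c)

lemma isRestricted_X_pow (r : ℝ) (n : ℕ) : PowerSeries.IsRestricted r (PowerSeries.X ^ n : F⟦X⟧) :=
  isRestricted_of_forall_lt _ n fun m hm => by
    rw [PowerSeries.coeff_X_pow, if_neg hm.ne']

lemma PowerSeries.IsRestricted.sub' {r : ℝ} {f g : F⟦X⟧} (hf : PowerSeries.IsRestricted r f)
    (hg : PowerSeries.IsRestricted r g) : PowerSeries.IsRestricted r (f - g) := by
  rw [sub_eq_add_neg]
  exact PowerSeries.isRestricted.add r hf (PowerSeries.isRestricted.neg r hg)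

/-- A geometric sequence of series converges coefficientwise, with the expected error bound. -/
lemma exists_tendsto_of_termBound [CompleteSpace F] {r C ε : ℝ} (hr : 0 < r) (hε : ε < 1)
    (f : ℕ → F⟦X⟧) (h : ∀ n, TermBound r (f (n + 1) - f n) (C * ε ^ n)) :
    ∃ g : F⟦X⟧, (∀ j, Tendsto (fun n => PowerSeries.coeff j (f n)) atTop
      (𝓝 (PowerSeries.coeff j g))) ∧ ∀ n, TermBound r (g - f n) (C * ε ^ n / (1 - ε)) := by
  have hd : ∀ j n, dist (PowerSeries.coeff j (f n)) (PowerSeries.coeff j (f (n + 1))) ≤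
      C / r ^ j * ε ^ n := by
    intro j n
    have := h n j
    rw [dist_comm, dist_eq_norm, ← map_sub, div_mul_eq_mul_div, le_div_iff₀ (by positivity)]
    exact this
  choose a ha using fun j => cauchySeq_tendsto_of_complete
    (cauchySeq_of_le_geometric ε (C / r ^ j) hε (hd j))
  refine ⟨PowerSeries.mk a, fun j => by simpa using ha j, fun n j => ?_⟩
  have := dist_le_of_le_geometric_of_tendsto ε (C / r ^ j) hε (hd j) (ha j) n
  rw [dist_comm, dist_eq_norm] at this
  rw [map_sub, PowerSeries.coeff_mk]
  calc ‖a j - PowerSeries.coeff j (f n)‖ * r ^ j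
      ≤ (C / r ^ j * ε ^ n / (1 - ε)) * r ^ j := by gcongr
    _ = C * ε ^ n / (1 - ε) := by field_simp

/-- Restricted series are closed under uniform limits for the Gauss norm; this puts the limit
cofactor in the Tate algebra of radius r. -/
lemma isRestricted_of_approx {r : ℝ} (hr : 0 < r) {g : F⟦X⟧} (f : ℕ → F⟦X⟧) (B : ℕ → ℝ)
    (hB : Tendsto B atTop (𝓝 0)) (hf : ∀ n, PowerSeries.IsRestricted r (f n))
    (h : ∀ n, TermBound r (g - f n) (B n)) : PowerSeries.IsRestricted r g := by
  rw [isRestricted_iff_tendsto, Metric.tendsto_atTop]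
  intro η hη
  obtain ⟨n, hn⟩ := (hB.eventually_lt_const (half_pos hη)).exists
  obtain ⟨N, hN⟩ := eventually_atTop.1
    ((isRestricted_iff_tendsto.1 (hf n)).eventually_lt_const (half_pos hη))
  refine ⟨N, fun j hj => ?_⟩
  rw [Real.dist_0_eq_abs, abs_of_nonneg (term_nonneg hr _ _)]
  have h1 := h n j
  have h2 := hN j hj
  rw [map_sub] at h1
  have h3 : ‖PowerSeries.coeff j g‖ ≤
      ‖PowerSeries.coeff j g - PowerSeries.coeff j (f n)‖ + ‖PowerSeries.coeff j (f n)‖ := by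
    simpa using norm_add_le (PowerSeries.coeff j g - PowerSeries.coeff j (f n))
      (PowerSeries.coeff j (f n))
  calc ‖PowerSeries.coeff j g‖ * r ^ j
      ≤ (‖PowerSeries.coeff j g - PowerSeries.coeff j (f n)‖ +
          ‖PowerSeries.coeff j (f n)‖) * r ^ j := by
        gcongr
    _ < η := by rw [add_mul]; linarith

/-- `E = P A + T ^ k D` with `A`, `D` bounded in terms of the bound `B` on `E`, and with `D`
supported in degrees `1, …, d`. -/
def HasDecomposition (r : ℝ) (P : F⟦X⟧) (d k : ℕ) (E : F⟦X⟧) (B : ℝ) : Prop :=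
  ∃ A D : F⟦X⟧, PowerSeries.IsRestricted r A ∧ TermBound r A B ∧ PowerSeries.coeff 0 D = 0 ∧
    (∀ n, d < n → PowerSeries.coeff n D = 0) ∧ TermBound r D (B / r ^ k) ∧
    E = P * A + PowerSeries.X ^ k * D

lemma HasDecomposition.mono {r : ℝ} (hr : 0 < r) {P E : F⟦X⟧} {d k : ℕ} {B B' : ℝ}
    (h : HasDecomposition r P d k E B) (hB : B ≤ B') : HasDecomposition r P d k E B' := by
  obtain ⟨A, D, h1, h2, h3, h4, h5, h6⟩ := h
  exact ⟨A, D, h1, h2.mono hB, h3, h4, h5.mono (by gcongr), h6⟩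

lemma hasDecomposition_zero {r : ℝ} (hr : 0 < r) {P : F⟦X⟧} {d k : ℕ} {B : ℝ} (hB : 0 ≤ B) :
    HasDecomposition r P d k 0 B :=
  ⟨0, 0, PowerSeries.isRestricted_zero r, termBound_zero hB, by simp, by simp,
    termBound_zero (by positivity), by simp⟩

lemma hasDecomposition_mul {r : ℝ} (hr : 0 < r) {P A : F⟦X⟧} {d k : ℕ} {B : ℝ} (hB : 0 ≤ B)
    (hA : PowerSeries.IsRestricted r A) (hAB : TermBound r A B) :
    HasDecomposition r P d k (P * A) B :=
  ⟨A, 0, hA, hAB, by simp, by simp, termBound_zero (by positivity), by simp⟩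

lemma eq_sum_range_of_forall_lt {P : F⟦X⟧} {d : ℕ}
    (hd : ∀ n, d < n → PowerSeries.coeff n P = 0) :
    P = ∑ i ∈ Finset.range (d + 1), PowerSeries.C (PowerSeries.coeff i P) * PowerSeries.X ^ i := by
  ext n
  rw [map_sum]
  simp only [PowerSeries.coeff_C_mul, PowerSeries.coeff_X_pow, mul_ite, mul_one, mul_zero,
    Finset.sum_ite_eq, Finset.mem_range]
  split_ifs with h
  · rfl
  · exact hd n (by omega)

variable [IsUltrametricDist F]

lemma TermBound.add {r B : ℝ} (hr : 0 < r) {f g : F⟦X⟧} (hf : TermBound r f B)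
    (hg : TermBound r g B) : TermBound r (f + g) B := fun n => by
  have hp : 0 < r ^ n := by positivity
  have h1 := hf n
  have h2 := hg n
  rw [← le_div_iff₀ hp] at h1 h2 ⊢
  rw [map_add]
  exact (IsUltrametricDist.norm_add_le_max _ _).trans (max_le h1 h2)

lemma TermBound.sub {r B : ℝ} (hr : 0 < r) {f g : F⟦X⟧} (hf : TermBound r f B)
    (hg : TermBound r g B) : TermBound r (f - g) B := by
  rw [sub_eq_add_neg]
  exact hf.add hr hg.neg

lemma TermBound.mul {r A B : ℝ} (hr : 0 < r) (hA : 0 ≤ A) (hB : 0 ≤ B) {f g : F⟦X⟧}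
    (hf : TermBound r f A) (hg : TermBound r g B) : TermBound r (f * g) (A * B) := fun n =>
  norm_coeff_mul_le hr (by positivity) fun a b _ =>
    mul_le_mul (hf a) (hg b) (term_nonneg hr g b) hA

lemma HasDecomposition.add {r : ℝ} (hr : 0 < r) {P E E' : F⟦X⟧} {d k : ℕ} {B : ℝ}
    (h : HasDecomposition r P d k E B) (h' : HasDecomposition r P d k E' B) :
    HasDecomposition r P d k (E + E') B := by
  obtain ⟨A, D, h1, h2, h3, h4, h5, h6⟩ := h
  obtain ⟨A', D', h1', h2', h3', h4', h5', h6'⟩ := h'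
  refine ⟨A + A', D + D', PowerSeries.isRestricted.add r h1 h1', h2.add hr h2',
    by rw [map_add, h3, h3', add_zero],
    fun n hn => by simp [h4 n hn, h4' n hn], h5.add hr h5', ?_⟩
  rw [h6, h6']
  ring

lemma HasDecomposition.C_mul {r : ℝ} {P E : F⟦X⟧} {d k : ℕ} {B : ℝ}
    (h : HasDecomposition r P d k E B) (c : F) :
    HasDecomposition r P d k (PowerSeries.C c * E) (‖c‖ * B) := by
  obtain ⟨A, D, h1, h2, h3, h4, h5, h6⟩ := h
  refine ⟨PowerSeries.C c * A, PowerSeries.C c * D,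
    PowerSeries.isRestricted.mul r (PowerSeries.isRestricted_C r c) h1, h2.C_mul c, ?_,
    fun n hn => ?_, ?_, ?_⟩
  · rw [PowerSeries.coeff_C_mul, h3, mul_zero]
  · rw [PowerSeries.coeff_C_mul, h4 n hn, mul_zero]
  · rw [mul_div_assoc]
    exact h5.C_mul c
  · rw [h6]; ring

lemma HasDecomposition.sum {r : ℝ} (hr : 0 < r) {P : F⟦X⟧} {d k : ℕ} {B : ℝ} (hB : 0 ≤ B)
    {ι : Type*} (s : Finset ι) (E : ι → F⟦X⟧) (h : ∀ i ∈ s, HasDecomposition r P d k (E i) B) :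
    HasDecomposition r P d k (∑ i ∈ s, E i) B := by
  classical
  induction s using Finset.induction_on with
  | empty => simpa using hasDecomposition_zero hr hB
  | insert a s ha ih =>
    rw [Finset.sum_insert ha]
    exact (h a (by simp)).add hr (ih fun i hi => h i (by simp [hi]))

/-- Monomials decompose with respect to a polynomial of degree `d` all of whose zeros have absolute
value `r`. -/
lemma hasDecomposition_X_pow {r : ℝ} (hr : 0 < r) {P : F⟦X⟧} {d : ℕ} (k : ℕ)
    (hP0 : PowerSeries.coeff 0 P = 1) (hPd : ‖PowerSeries.coeff d P‖ * r ^ d = 1)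
    (hd : ∀ n, d < n → PowerSeries.coeff n P = 0) (hP : TermBound r P 1) (n : ℕ) :
    HasDecomposition r P d k (PowerSeries.X ^ n) (r ^ n) := by
  have hsum : ∀ Q, P * Q = ∑ i ∈ Finset.range (d + 1),
      PowerSeries.C (PowerSeries.coeff i P) * PowerSeries.X ^ i * Q := fun Q => by
    conv_lhs => rw [eq_sum_range_of_forall_lt hd, Finset.sum_mul]
  have hmid : ∀ n, k < n → n ≤ k + d →
      HasDecomposition r P d k (PowerSeries.X ^ n : F⟦X⟧) (r ^ n) := by
    intro n hkn hnd
    obtain ⟨m, rfl⟩ : ∃ m, n = k + m := ⟨n - k, by omega⟩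
    refine ⟨0, PowerSeries.X ^ m, PowerSeries.isRestricted_zero r, termBound_zero (by positivity),
      ?_, fun n hn => ?_, ?_, ?_⟩
    · rw [PowerSeries.coeff_X_pow, if_neg (by omega)]
    · rw [PowerSeries.coeff_X_pow, if_neg (by omega)]
    · rw [pow_add, mul_div_cancel_left₀ _ (by positivity)]
      exact termBound_X_pow hr m
    · rw [mul_zero, zero_add, pow_add]
  -- High powers are lowered by Euclidean division; the inverse leading coefficient has norm exactly
  -- r^d, so no bound is lost.
  have hhigh : ∀ n, k < n → HasDecomposition r P d k (PowerSeries.X ^ n : F⟦X⟧) (r ^ n) := by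
    intro n
    induction n using Nat.strong_induction_on with
    | _ n ih =>
      intro hkn
      rcases le_or_gt n (k + d) with hnd | hnd
      · exact hmid n hkn hnd
      obtain ⟨m, rfl⟩ : ∃ m, n = m + d := ⟨n - d, by omega⟩
      have hp0 : PowerSeries.coeff d P ≠ 0 := by
        intro h0
        rw [h0, norm_zero, zero_mul] at hPd
        exact zero_ne_one hPd
      have hinv : ‖(PowerSeries.coeff d P)⁻¹‖ = r ^ d := by
        rw [norm_inv, inv_eq_of_mul_eq_one_right hPd]
      have heq : (PowerSeries.X ^ (m + d) : F⟦X⟧) =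
          P * (PowerSeries.C (PowerSeries.coeff d P)⁻¹ * PowerSeries.X ^ m) +
          ∑ i ∈ Finset.range d,
            PowerSeries.C (-((PowerSeries.coeff d P)⁻¹ * PowerSeries.coeff i P)) *
            PowerSeries.X ^ (m + i) := by
        have h1 : P * (PowerSeries.C (PowerSeries.coeff d P)⁻¹ * PowerSeries.X ^ m) =
          ∑ i ∈ Finset.range (d + 1),
            PowerSeries.C ((PowerSeries.coeff d P)⁻¹ * PowerSeries.coeff i P) *
              PowerSeries.X ^ (m + i) := by
          rw [hsum]
          refine Finset.sum_congr rfl fun i _ => ?_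
          rw [map_mul, pow_add]
          ring
        rw [h1, Finset.sum_range_succ, inv_mul_cancel₀ hp0, map_one, one_mul]
        simp only [map_neg, neg_mul, Finset.sum_neg_distrib]
        ring
      rw [heq]
      refine (hasDecomposition_mul hr (by positivity) ?_ ?_).add hr
        (HasDecomposition.sum hr (by positivity) _ _ fun i hi => ?_)
      · exact PowerSeries.isRestricted.mul r (PowerSeries.isRestricted_C r _)
          (isRestricted_X_pow r m)
      · refine ((termBound_X_pow hr m).C_mul _).mono (le_of_eq ?_)
        rw [hinv, pow_add, mul_comm]
      · rw [Finset.mem_range] at hi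
        refine ((ih (m + i) (by omega) (by omega)).C_mul _).mono hr ?_
        rw [norm_neg, norm_mul, hinv, pow_add, pow_add]
        have := hP i
        calc r ^ d * ‖PowerSeries.coeff i P‖ * (r ^ m * r ^ i)
            = r ^ m * r ^ d * (‖PowerSeries.coeff i P‖ * r ^ i) := by ring
          _ ≤ r ^ m * r ^ d * 1 := by gcongr
          _ = r ^ m * r ^ d := mul_one _
  -- Low powers are raised instead, using the constant term 1 of P; j = k + 1 - n measures what
  -- remains to be climbed.
  have hlow : ∀ j n, n + j = k + 1 →
      HasDecomposition r P d k (PowerSeries.X ^ n : F⟦X⟧) (r ^ n) := by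
    intro j
    induction j using Nat.strong_induction_on with
    | _ j ih =>
      intro n hnj
      rcases Nat.eq_zero_or_pos j with rfl | hj
      · exact hhigh n (by omega)
      have heq : (PowerSeries.X ^ n : F⟦X⟧) = P * PowerSeries.X ^ n +
          ∑ i ∈ Finset.range d, PowerSeries.C (-PowerSeries.coeff (i + 1) P) *
            PowerSeries.X ^ (n + (i + 1)) := by
        have h1 : P * PowerSeries.X ^ n = ∑ i ∈ Finset.range (d + 1),
            PowerSeries.C (PowerSeries.coeff i P) * PowerSeries.X ^ (n + i) := by
          rw [hsum]
          refine Finset.sum_congr rfl fun i _ => ?_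
          rw [pow_add]
          ring
        rw [h1, Finset.sum_range_succ', hP0]
        simp only [map_neg, neg_mul, Finset.sum_neg_distrib, map_one, one_mul, add_zero]
        ring
      rw [heq]
      refine (hasDecomposition_mul hr (by positivity) (isRestricted_X_pow r n)
        (termBound_X_pow hr n)).add hr (HasDecomposition.sum hr (by positivity) _ _ fun i _ => ?_)
      have hrec : HasDecomposition r P d k (PowerSeries.X ^ (n + (i + 1)) : F⟦X⟧)
          (r ^ (n + (i + 1))) := by
        rcases le_or_gt (n + (i + 1)) k with h | h
        · exact ih (j - (i + 1)) (by omega) _ (by omega)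
        · exact hhigh _ h
      refine (hrec.C_mul _).mono hr ?_
      rw [norm_neg, pow_add]
      have := hP (i + 1)
      calc ‖PowerSeries.coeff (i + 1) P‖ * (r ^ n * r ^ (i + 1))
          = r ^ n * (‖PowerSeries.coeff (i + 1) P‖ * r ^ (i + 1)) := by ring
        _ ≤ r ^ n * 1 := by gcongr
        _ = r ^ n := mul_one _
  rcases le_or_gt n k with h | h
  · exact hlow (k + 1 - n) n (by omega)
  · exact hhigh n h

/-- Restricted series decompose approximately. -/
lemma exists_approx_decomposition {r : ℝ} (hr : 0 < r) {P : F⟦X⟧} {d : ℕ} (k : ℕ)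
    (hP0 : PowerSeries.coeff 0 P = 1) (hPd : ‖PowerSeries.coeff d P‖ * r ^ d = 1)
    (hd : ∀ n, d < n → PowerSeries.coeff n P = 0) (hP : TermBound r P 1) {E : F⟦X⟧} {B η : ℝ}
    (hB : 0 ≤ B) (hη : 0 < η) (hE : PowerSeries.IsRestricted r E) (hEB : TermBound r E B) :
    ∃ E', HasDecomposition r P d k E' B ∧ TermBound r (E - E') η := by
  obtain ⟨N, hN⟩ := eventually_atTop.1
    ((isRestricted_iff_tendsto.1 hE).eventually_le_const hη)
  -- A truncation avoids summing infinitely many decompositions; the tail, of size at most η, is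
  -- left to the next iteration.
  refine ⟨∑ i ∈ Finset.range N, PowerSeries.C (PowerSeries.coeff i E) * PowerSeries.X ^ i,
    HasDecomposition.sum hr hB _ _ fun i _ =>
      ((hasDecomposition_X_pow hr k hP0 hPd hd hP i).C_mul _).mono hr (hEB i), fun n => ?_⟩
  rw [map_sub, map_sum]
  simp only [PowerSeries.coeff_C_mul, PowerSeries.coeff_X_pow, mul_ite, mul_one, mul_zero,
    Finset.sum_ite_eq, Finset.mem_range]
  split_ifs with h
  · simpa using hη.le
  · simpa using hN n (by omega)

/-- The state of the iteration for the factorization of `φ` near `P₀ * T ^ k`. -/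
structure IsApproxFactorization (r ε : ℝ) (φ P₀ : F⟦X⟧) (d k n : ℕ) (x : F⟦X⟧ × F⟦X⟧) : Prop where
  restricted : PowerSeries.IsRestricted r x.2
  coeff_zero : PowerSeries.coeff 0 x.1 = 1
  coeff_gt : ∀ n, d < n → PowerSeries.coeff n x.1 = 0
  bound_fst : TermBound r (x.1 - P₀) ε
  bound_snd : TermBound r (x.2 - PowerSeries.X ^ k) (ε * r ^ k)
  bound : TermBound r (φ - x.1 * x.2) (ε ^ (n + 1) * r ^ k)

/-- A simplified Newton step: the error is divided with respect to the fixed pair (P₀, T^k), not the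
current factors. These stay within relative distance ε of that pair, so each step still gains a
factor ε. -/
lemma IsApproxFactorization.exists_next {r ε : ℝ} (hr : 0 < r) (hε0 : 0 < ε) (hε1 : ε < 1)
    {φ P₀ : F⟦X⟧} {d k : ℕ} (hφ : PowerSeries.IsRestricted r φ)
    (hP0 : PowerSeries.coeff 0 P₀ = 1) (hPd : ‖PowerSeries.coeff d P₀‖ * r ^ d = 1)
    (hd : ∀ n, d < n → PowerSeries.coeff n P₀ = 0) (hP : TermBound r P₀ 1) {n : ℕ}
    {x : F⟦X⟧ × F⟦X⟧} (h : IsApproxFactorization r ε φ P₀ d k n x) :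
    ∃ y, IsApproxFactorization r ε φ P₀ d k (n + 1) y ∧ TermBound r (y.1 - x.1) (ε * ε ^ n) ∧
      TermBound r (y.2 - x.2) (ε * r ^ k * ε ^ n) := by
  have hres : PowerSeries.IsRestricted r (φ - x.1 * x.2) :=
    hφ.sub' (PowerSeries.isRestricted.mul r (isRestricted_of_forall_lt _ d h.coeff_gt) h.restricted)
  obtain ⟨E', ⟨A, D, hA, hAB, hD0, hDd, hDB, rfl⟩, hE'⟩ :=
    exists_approx_decomposition hr k hP0 hPd hd hP (B := ε ^ (n + 1) * r ^ k)
      (η := ε ^ (n + 2) * r ^ k) (by positivity) (by positivity) hres h.bound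
  rw [mul_div_cancel_right₀ _ (by positivity)] at hDB
  have hpow : ε ^ (n + 1) ≤ ε := pow_le_of_le_one hε0.le hε1.le (by omega)
  refine ⟨(x.1 + D, x.2 + A), ⟨PowerSeries.isRestricted.add r h.restricted hA, ?_, fun m hm => ?_,
    ?_, ?_, ?_⟩, ?_, ?_⟩
  · rw [map_add, h.coeff_zero, hD0, add_zero]
  · simp [h.coeff_gt m hm, hDd m hm]
  · rw [add_sub_right_comm]
    exact h.bound_fst.add hr (hDB.mono hpow)
  · rw [add_sub_right_comm]
    exact h.bound_snd.add hr (hAB.mono (by gcongr))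
  · have heq : φ - (x.1 + D) * (x.2 + A) = (φ - x.1 * x.2 - (P₀ * A + PowerSeries.X ^ k * D)) -
        (x.1 - P₀) * A - D * (x.2 - PowerSeries.X ^ k) - D * A := by ring
    show TermBound r (φ - (x.1 + D) * (x.2 + A)) _
    rw [heq]
    refine ((hE'.sub hr ?_).sub hr ?_).sub hr ?_
    · refine (h.bound_fst.mul hr hε0.le (by positivity) hAB).mono (le_of_eq ?_)
      ring
    · refine (hDB.mul hr (by positivity) (by positivity) h.bound_snd).mono (le_of_eq ?_)
      ring
    · refine (hDB.mul hr (by positivity) (by positivity) hAB).mono ?_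
      calc ε ^ (n + 1) * (ε ^ (n + 1) * r ^ k) ≤ ε * (ε ^ (n + 1) * r ^ k) := by gcongr
        _ = ε ^ (n + 1 + 1) * r ^ k := by ring
  · rw [add_sub_cancel_left, ← pow_succ']
    exact hDB
  · rw [add_sub_cancel_left]
    exact hAB.mono (le_of_eq (by ring))

/-- The iteration starts from the coefficients of φ in degrees k, …, k + d. Outside this range the
terms are uniformly smaller than r^k because they tend to 0, and the resulting ratio is ε. -/
lemma exists_factorization_of_coeff_eq_one [CompleteSpace F] {r : ℝ} (hr : 0 < r) {φ : F⟦X⟧}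
    {k d : ℕ} (hφ : PowerSeries.IsRestricted r φ) (hk : FirstDominant r φ k)
    (hl : LastDominant r φ (k + d)) (h1 : PowerSeries.coeff k φ = 1) :
    ∃ P ψ : F⟦X⟧, PowerSeries.coeff 0 P = 1 ∧ (∀ n, d < n → PowerSeries.coeff n P = 0) ∧
      FirstDominant r P 0 ∧ LastDominant r P d ∧ PowerSeries.IsRestricted r ψ ∧ φ = P * ψ := by
  have hkval : ‖PowerSeries.coeff k φ‖ * r ^ k = r ^ k := by rw [h1, norm_one, one_mul]
  have hrk : 0 < r ^ k := by positivity
  set P₀ : F⟦X⟧ := PowerSeries.mk fun i => if i ≤ d then PowerSeries.coeff (k + i) φ else 0 with hP₀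
  have hP0 : PowerSeries.coeff 0 P₀ = 1 := by simp [hP₀, h1]
  have hd : ∀ n, d < n → PowerSeries.coeff n P₀ = 0 := fun n hn => by
    simp [hP₀, not_le.2 hn]
  have hP : TermBound r P₀ 1 := fun i => by
    rw [hP₀, PowerSeries.coeff_mk]
    split_ifs with hi
    · have := hk.1.2 (k + i)
      rw [hkval, pow_add] at this
      refine le_of_mul_le_mul_left (?_ : r ^ k * _ ≤ r ^ k * 1) hrk
      linarith
    · simp
  have hPd : ‖PowerSeries.coeff d P₀‖ * r ^ d = 1 := by
    rw [hP₀, PowerSeries.coeff_mk, if_pos le_rfl]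
    have := hl.1.term_eq hk.1
    rw [hkval, pow_add] at this
    refine mul_left_cancel₀ hrk.ne' (Eq.trans ?_ (this.trans ?_)) <;> ring
  obtain ⟨B, hB0, hBlt, hB⟩ := exists_lt_bound_of_tendsto_zero (isRestricted_iff_tendsto.1 hφ)
    hrk {n | n < k ∨ k + d < n} fun n hn => by
      rcases hn with h | h
      · exact hkval ▸ hk.2 n h
      · exact (hl.2 n h).trans_le (hkval ▸ hk.1.2 _)
  set ε := B / r ^ k with hεdef
  have hε0 : 0 < ε := by positivity
  have hε1 : ε < 1 := (div_lt_one hrk).2 hBlt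
  have hεB : ε * r ^ k = B := div_mul_cancel₀ _ hrk.ne'
  have hstart : IsApproxFactorization r ε φ P₀ d k 0 (P₀, PowerSeries.X ^ k) := by
    refine ⟨isRestricted_X_pow r k, hP0, hd, ?_, ?_, ?_⟩
    · rw [sub_self]; exact termBound_zero hε0.le
    · rw [sub_self]; exact termBound_zero (by positivity)
    · intro n
      rw [zero_add, pow_one, hεB, map_sub, PowerSeries.coeff_mul_X_pow', hP₀]
      by_cases hkn : k ≤ n
      · rw [if_pos hkn, PowerSeries.coeff_mk]
        split_ifs with hnd
        · rw [Nat.add_sub_cancel' hkn, sub_self, norm_zero, zero_mul]; exact hB0.le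
        · rw [sub_zero]; exact hB n (Or.inr (by omega))
      · rw [if_neg hkn, sub_zero]; exact hB n (Or.inl (by omega))
  have hnext : ∀ n x, IsApproxFactorization r ε φ P₀ d k n x → ∃ y,
      IsApproxFactorization r ε φ P₀ d k (n + 1) y ∧ TermBound r (y.1 - x.1) (ε * ε ^ n) ∧
      TermBound r (y.2 - x.2) (ε * r ^ k * ε ^ n) :=
    fun n x h => h.exists_next hr hε0 hε1 hφ hP0 hPd hd hP
  choose! next hnext using hnext
  let x : ℕ → F⟦X⟧ × F⟦X⟧ := fun n => Nat.rec (P₀, PowerSeries.X ^ k) next n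
  have hx : ∀ n, IsApproxFactorization r ε φ P₀ d k n (x n) := by
    intro n
    induction n with
    | zero => exact hstart
    | succ n ih => exact (hnext n (x n) ih).1
  obtain ⟨P, hPlim, -⟩ := exists_tendsto_of_termBound hr hε1 (fun n => (x n).1)
    fun n => (hnext n (x n) (hx n)).2.1
  obtain ⟨ψ, hψlim, hψB⟩ := exists_tendsto_of_termBound hr hε1 (fun n => (x n).2)
    fun n => (hnext n (x n) (hx n)).2.2
  have hP0' : PowerSeries.coeff 0 P = 1 :=
    tendsto_nhds_unique (hPlim 0) (tendsto_const_nhds.congr fun n => ((hx n).coeff_zero).symm)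
  have hd' : ∀ m, d < m → PowerSeries.coeff m P = 0 := fun m hm =>
    tendsto_nhds_unique (hPlim m) (tendsto_const_nhds.congr fun n => ((hx n).coeff_gt m hm).symm)
  have hPP₀ : TermBound r (P - P₀) ε := fun m => by
    have hlim : Tendsto (fun n => ‖PowerSeries.coeff m ((x n).1 - P₀)‖ * r ^ m) atTop
        (𝓝 (‖PowerSeries.coeff m (P - P₀)‖ * r ^ m)) := by
      simp only [map_sub]
      exact ((hPlim m).sub_const _).norm.mul_const _
    exact le_of_tendsto' hlim fun n => (hx n).bound_fst m
  have hPbound : TermBound r P 1 := by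
    have := (hPP₀.mono hε1.le).add hr hP
    rwa [sub_add_cancel] at this
  -- P differs from P₀ by less than the size of the top term, so the degree does not drop in the
  -- limit.
  have hPd' : ‖PowerSeries.coeff d P‖ = ‖PowerSeries.coeff d P₀‖ := by
    apply norm_eq_of_norm_sub_lt
    refine lt_of_mul_lt_mul_right (lt_of_le_of_lt ?_ (hPd.symm ▸ hε1)) (pow_nonneg hr.le d)
    rw [← map_sub]
    exact hPP₀ d
  refine ⟨P, ψ, hP0', hd', ⟨⟨by simp [hP0'], fun j => ?_⟩, by simp⟩, ⟨⟨?_, fun j => ?_⟩,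
    fun j hj => ?_⟩, ?_, ?_⟩
  · rw [hP0', norm_one, pow_zero, mul_one]
    exact hPbound j
  · intro h0
    rw [← hPd', h0, norm_zero, zero_mul] at hPd
    exact zero_ne_one hPd
  · rw [hPd', hPd]; exact hPbound j
  · rw [hPd', hPd, hd' j hj, norm_zero, zero_mul]; exact zero_lt_one
  · refine isRestricted_of_approx hr (fun n => (x n).2) _ ?_ (fun n => (hx n).restricted) hψB
    have := (((tendsto_pow_atTop_nhds_zero_of_lt_one hε0.le hε1).const_mul (ε * r ^ k)).div_const
      (1 - ε))
    simpa using this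
  · ext m
    have hlim1 : Tendsto (fun n => PowerSeries.coeff m ((x n).1 * (x n).2)) atTop
        (𝓝 (PowerSeries.coeff m (P * ψ))) := by
      simp only [PowerSeries.coeff_mul]
      exact tendsto_finsetSum _ fun i _ => (hPlim i.1).mul (hψlim i.2)
    have hlim2 : Tendsto (fun n => PowerSeries.coeff m ((x n).1 * (x n).2)) atTop
        (𝓝 (PowerSeries.coeff m φ)) := by
      rw [tendsto_iff_norm_sub_tendsto_zero]
      have hz : Tendsto (fun n : ℕ => ε ^ n * (ε * r ^ k / r ^ m)) atTop (𝓝 0) := by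
        simpa using (tendsto_pow_atTop_nhds_zero_of_lt_one hε0.le hε1).mul_const
          (ε * r ^ k / r ^ m)
      refine squeeze_zero (fun n => norm_nonneg _) (fun n => ?_) hz
      have := (hx n).bound m
      rw [← le_div_iff₀ (by positivity)] at this
      rw [norm_sub_rev, ← map_sub]
      refine this.trans (le_of_eq ?_)
      ring
    exact tendsto_nhds_unique hlim2 hlim1

/-- Factorization of a restricted series along a segment of its Newton polygon. -/
theorem exists_factorization [CompleteSpace F] {r : ℝ} (hr : 0 < r) {φ : F⟦X⟧}
    {k d : ℕ} (hφ : PowerSeries.IsRestricted r φ) (hk : FirstDominant r φ k)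
    (hl : LastDominant r φ (k + d)) :
    ∃ P ψ : F⟦X⟧, PowerSeries.coeff 0 P = 1 ∧ (∀ n, d < n → PowerSeries.coeff n P = 0) ∧
      FirstDominant r P 0 ∧ LastDominant r P d ∧ PowerSeries.IsRestricted r ψ ∧ φ = P * ψ := by
  set c := PowerSeries.coeff k φ with hc
  have hc0 : c ≠ 0 := hk.1.1
  have hcinv : 0 < ‖c⁻¹‖ := norm_pos_iff.2 (inv_ne_zero hc0)
  have hterm : ∀ j, ‖PowerSeries.coeff j (PowerSeries.C c⁻¹ * φ)‖ * r ^ j =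
      ‖c⁻¹‖ * (‖PowerSeries.coeff j φ‖ * r ^ j) := fun j => by
    rw [PowerSeries.coeff_C_mul, norm_mul, mul_assoc]
  have hdom : ∀ i, DominantAt r φ i → DominantAt r (PowerSeries.C c⁻¹ * φ) i := fun i hi => by
    refine ⟨?_, fun j => ?_⟩
    · rw [PowerSeries.coeff_C_mul]
      exact mul_ne_zero (inv_ne_zero hc0) hi.1
    · rw [hterm, hterm]
      exact mul_le_mul_of_nonneg_left (hi.2 j) hcinv.le
  obtain ⟨P, ψ, h1, h2, h3, h4, h5, h6⟩ := exists_factorization_of_coeff_eq_one hr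
    (PowerSeries.isRestricted.mul r (PowerSeries.isRestricted_C r c⁻¹) hφ)
    (k := k) (d := d)
    ⟨hdom k hk.1, fun j hj => by
      rw [hterm, hterm]; exact mul_lt_mul_of_pos_left (hk.2 j hj) hcinv⟩
    ⟨hdom _ hl.1, fun j hj => by
      rw [hterm, hterm]; exact mul_lt_mul_of_pos_left (hl.2 j hj) hcinv⟩
    (by rw [PowerSeries.coeff_C_mul, inv_mul_cancel₀ hc0])
  refine ⟨P, PowerSeries.C c * ψ, h1, h2, h3, h4,
    PowerSeries.isRestricted.mul r (PowerSeries.isRestricted_C r c) h5, ?_⟩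
  rw [mul_left_comm, ← h6, ← mul_assoc, ← map_mul, mul_inv_cancel₀ hc0, map_one, one_mul]

/-- A product `P * χ = S * ψ` with `S` of degree less than the number of zeros of `P` on the circle
of radius `r`, and `ψ` without zeros there, forces `S = 0`. -/
lemma eq_zero_of_mul_eq_mul {r : ℝ} (hr : 0 < r) {P χ S ψ : F⟦X⟧} {d k : ℕ}
    (hP1 : FirstDominant r P 0) (hP2 : LastDominant r P d) (hχ : PowerSeries.IsRestricted r χ)
    (hψ1 : FirstDominant r ψ k) (hψ2 : LastDominant r ψ k)
    (hS : ∀ n, d ≤ n → PowerSeries.coeff n S = 0) (h : P * χ = S * ψ) : S = 0 := by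
  by_contra hS0
  have hSres : PowerSeries.IsRestricted r S := isRestricted_of_forall_lt _ d fun n hn => hS n hn.le
  have hχ0 : χ ≠ 0 := by
    rintro rfl
    rw [mul_zero] at h
    exact hψ2.not_eq_zero ((mul_eq_zero.1 h.symm).resolve_left hS0)
  obtain ⟨a, ha⟩ := exists_lastDominant hr hSres hS0
  obtain ⟨a', ha'⟩ := ha.1.exists_firstDominant hr
  obtain ⟨b, hb⟩ := exists_lastDominant hr hχ hχ0
  obtain ⟨b', hb'⟩ := hb.1.exists_firstDominant hr
  -- Comparing the distances between first and last dominant indices on both sides gives d + (b -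
  -- b') = a - a' ≤ a < d, which is absurd.
  have e1 := (hP2.mul hr hb).unique (h ▸ ha.mul hr hψ2)
  have e2 := (hP1.mul hr hb').unique (h ▸ ha'.mul hr hψ1)
  have e3 := hb'.le hb.1
  have e4 : a < d := by
    by_contra! hda
    exact ha.1.1 (hS a hda)
  omega

end Hensel

/-! ### Existence and uniqueness of the slope factorization -/

section SlopeFactorization

variable {F : Type*} [NormedField F]

lemma DominantAt.zero_of_le {r ρ : ℝ} (hρ : 0 < ρ) (hρr : ρ ≤ r) {f : F⟦X⟧}
    (h : DominantAt r f 0) : DominantAt ρ f 0 := by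
  refine ⟨h.1, fun j => le_trans ?_ ((h.2 j).trans (le_of_eq (by simp)))⟩
  gcongr

lemma DominantAt.of_ge {r ρ : ℝ} (hr : 0 < r) (hrρ : r ≤ ρ) {f : F⟦X⟧} {d : ℕ}
    (h : DominantAt r f d) (hd : ∀ n, d < n → PowerSeries.coeff n f = 0) : DominantAt ρ f d := by
  have hρ : 0 < ρ := hr.trans_le hrρ
  refine ⟨h.1, fun j => ?_⟩
  rcases le_or_gt j d with hj | hj
  · have e1 : ∀ x : ℝ, ∀ n : ℕ, x * ρ ^ n = x * r ^ n * (ρ / r) ^ n := fun x n => by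
      rw [div_pow]; field_simp
    rw [e1 _ j, e1 _ d]
    exact mul_le_mul (h.2 j) (pow_le_pow_right₀ ((one_le_div hr).2 hrρ) hj) (by positivity)
      (term_nonneg hr f d)
  · rw [hd j hj, norm_zero, zero_mul]
    exact term_nonneg hρ f d

lemma coeff_coe_eq_zero {P : F[X]} {n : ℕ} (h : P.natDegree < n) :
    PowerSeries.coeff n (P : F⟦X⟧) = 0 := by
  rw [Polynomial.coeff_coe, Polynomial.coeff_eq_zero_of_natDegree_lt h]

lemma coeff_natDegree_coe_ne_zero {P : F[X]} (h : 0 < P.natDegree) :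
    PowerSeries.coeff P.natDegree (P : F⟦X⟧) ≠ 0 := by
  rw [Polynomial.coeff_coe]
  exact Polynomial.leadingCoeff_ne_zero.2 (Polynomial.ne_zero_of_natDegree_gt h)

/-- A nonconstant polynomial with nonzero constant term has `log r` as its only slope if and only
if its first and last terms are dominant at radius `r`. -/
lemma forall_isSlope_iff_dominantAt {r : ℝ} (hr : 0 < r) {P : F[X]} (hd : 0 < P.natDegree)
    (h0 : PowerSeries.coeff 0 (P : F⟦X⟧) ≠ 0) :
    (∀ s : ℝ, IsSlope (newtonPolygon (P : F⟦X⟧)) s ↔ s = Real.log r) ↔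
      FirstDominant r (P : F⟦X⟧) 0 ∧ LastDominant r (P : F⟦X⟧) P.natDegree := by
  constructor
  · intro h
    -- Every unit interval below the degree carries a slope, so all critical radii equal r. Index 0
    -- then makes the constant term dominant, and the last index makes the top term win just above
    -- r.
    have hcrit : ∀ n < P.natDegree, IsCritical (P : F⟦X⟧) n r := by
      intro n hn
      obtain ⟨s, hs⟩ := exists_isCritical one_pos (isRestricted_coe 1 P) h0 hn
        (coeff_natDegree_coe_ne_zero hd)
      have := (h (Real.log s)).1 ⟨_, _, hs.hasSlopeOn⟩
      rwa [Real.log_injOn_pos hs.1 hr this] at hs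
    obtain ⟨j, hj, hdom⟩ := (hcrit 0 hd).2.1
    obtain rfl := Nat.le_zero.1 hj
    have hle : ∀ y, r < y → ‖PowerSeries.coeff 0 (P : F⟦X⟧)‖ * y ^ 0 ≤
        ‖PowerSeries.coeff P.natDegree (P : F⟦X⟧)‖ * y ^ P.natDegree := by
      intro y hy
      obtain ⟨k, hk, hlt⟩ := (hcrit (P.natDegree - 1) (by omega)).2.2 y hy
      have h1 := hlt 0 (Nat.zero_le _)
      rcases (show P.natDegree ≤ k by omega).eq_or_lt with rfl | hk'
      · exact h1.le
      · rw [coeff_coe_eq_zero hk', norm_zero, zero_mul] at h1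
        exact absurd (term_nonneg (hr.trans hy) _ 0) (not_le.2 h1)
    have hle' : ‖PowerSeries.coeff 0 (P : F⟦X⟧)‖ * r ^ 0 ≤
        ‖PowerSeries.coeff P.natDegree (P : F⟦X⟧)‖ * r ^ P.natDegree := by
      have hcont : ∀ j : ℕ, Tendsto (fun y : ℝ => ‖PowerSeries.coeff j (P : F⟦X⟧)‖ * y ^ j)
          (𝓝[>] r) (𝓝 (‖PowerSeries.coeff j (P : F⟦X⟧)‖ * r ^ j)) := fun j =>
        ((by fun_prop : Continuous fun y : ℝ => ‖PowerSeries.coeff j (P : F⟦X⟧)‖ * y ^ j).tendsto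
          r).mono_left nhdsWithin_le_nhds
      exact le_of_tendsto_of_tendsto (hcont 0) (hcont _)
        (by filter_upwards [self_mem_nhdsWithin] with y hy using hle y hy)
    refine ⟨⟨hdom, by simp⟩, ⟨coeff_natDegree_coe_ne_zero hd, fun j => (hdom.2 j).trans hle'⟩,
      fun j hj => ?_⟩
    rw [coeff_coe_eq_zero hj, norm_zero, zero_mul]
    exact term_pos hr (coeff_natDegree_coe_ne_zero hd)
  · rintro ⟨h1, h2⟩ s
    constructor
    · intro hs
      rw [← Real.log_exp s] at hs
      by_contra hne
      -- The constant term stays dominant at radii below r and the top term at radii above r, so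
      -- neither side carries a slope.
      rcases lt_or_gt_of_ne hne with hlt | hlt
      · rw [Real.lt_log_iff_exp_lt hr] at hlt
        exact not_isSlope_of_dominantAt (half_pos (Real.exp_pos s)) (half_lt_self (Real.exp_pos s))
          hlt (h1.1.zero_of_le (half_pos (Real.exp_pos s))
            ((half_lt_self (Real.exp_pos s)).trans hlt).le) h1.1 hs
      · rw [Real.log_lt_iff_lt_exp hr] at hlt
        exact not_isSlope_of_dominantAt hr hlt (lt_add_one _) h2.1
          (h2.1.of_ge hr (hlt.trans (lt_add_one _)).le fun n => coeff_coe_eq_zero) hs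
    · rintro rfl
      exact ⟨_, _, h1.1.hasSlopeOn hr h2.1 hd⟩

variable {r R : ℝ} {φ ψ : F⟦X⟧} {P : F[X]} {k d : ℕ}

lemma IsSlopeFactorization.coeff_zero {μ : ℝ} (h : IsSlopeFactorization R φ d μ P ψ) :
    PowerSeries.coeff 0 (P : F⟦X⟧) = 1 := by
  rw [Polynomial.coeff_coe, Polynomial.coeff_zero_eq_eval_zero, h.2.1]

lemma IsSlopeFactorization.dominant (hr : 0 < r) (hd : 0 < d)
    (h : IsSlopeFactorization R φ d (Real.log r) P ψ) :
    FirstDominant r (P : F⟦X⟧) 0 ∧ LastDominant r (P : F⟦X⟧) d := by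
  have h0 := h.coeff_zero
  obtain ⟨rfl, -, h3, -, -⟩ := h
  exact (forall_isSlope_iff_dominantAt hr hd (by rw [h0]; exact one_ne_zero)).1 h3

variable [IsUltrametricDist F]

/-- P accounts for the full width d of the edge, so additivity of the first and last dominant
indices leaves width 0 for ψ. -/
lemma IsSlopeFactorization.dominant_snd (hr : 0 < r) (hrR : r ≤ R) (hd : 0 < d)
    (hk : FirstDominant r φ k) (hl : LastDominant r φ (k + d))
    (h : IsSlopeFactorization R φ d (Real.log r) P ψ) :
    FirstDominant r ψ k ∧ LastDominant r ψ k := by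
  obtain ⟨h1, h2⟩ := h.dominant hr hd
  obtain ⟨-, -, -, hψ, rfl⟩ := h
  have hψ0 : ψ ≠ 0 := by
    rintro rfl
    exact hl.not_eq_zero (mul_zero _)
  obtain ⟨b, hb⟩ := exists_lastDominant hr (hψ.of_le hr hrR) hψ0
  obtain ⟨b', hb'⟩ := hb.1.exists_firstDominant hr
  have e1 := hk.unique (h1.mul hr hb')
  have e2 := hl.unique (h2.mul hr hb)
  obtain rfl : k = b' := by omega
  obtain rfl : k = b := by omega
  exact ⟨hb', hb⟩

lemma IsSlopeFactorization.unique {P' : F[X]} {ψ' : F⟦X⟧} (hr : 0 < r) (hrR : r ≤ R) (hd : 0 < d)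
    (hk : FirstDominant r φ k) (hl : LastDominant r φ (k + d))
    (h : IsSlopeFactorization R φ d (Real.log r) P ψ)
    (h' : IsSlopeFactorization R φ d (Real.log r) P' ψ') : P = P' ∧ ψ = ψ' := by
  obtain ⟨h1, h2⟩ := h.dominant hr hd
  obtain ⟨h3, h4⟩ := h'.dominant_snd hr hrR hd hk hl
  -- This q cancels the top coefficient, so S = P' - q P has degree < d while S ψ' = P (ψ - q ψ');
  -- the constant terms then force q = 1.
  set q := PowerSeries.coeff d (P' : F⟦X⟧) / PowerSeries.coeff d (P : F⟦X⟧) with hq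
  have hS : (P' : F⟦X⟧) - PowerSeries.C q * (P : F⟦X⟧) = 0 := by
    refine eq_zero_of_mul_eq_mul hr h1 h2 (χ := ψ - PowerSeries.C q * ψ') (ψ := ψ') (k := k)
      ?_ h3 h4 (fun n hn => ?_) ?_
    · exact (h.2.2.2.1.of_le hr hrR).sub' (PowerSeries.isRestricted.mul r
        (PowerSeries.isRestricted_C r q) (h'.2.2.2.1.of_le hr hrR))
    · rw [map_sub, PowerSeries.coeff_C_mul]
      rcases hn.eq_or_lt with rfl | hn
      · rw [hq, div_mul_cancel₀ _ h2.1.1, sub_self]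
      · rw [coeff_coe_eq_zero (h'.1 ▸ hn), coeff_coe_eq_zero (h.1 ▸ hn), mul_zero, sub_zero]
    · have := h.2.2.2.2.symm.trans h'.2.2.2.2
      rw [mul_sub, this]
      ring
  have hq1 : q = 1 := by
    have := congrArg (PowerSeries.coeff 0) hS
    rw [map_sub, PowerSeries.coeff_C_mul, h.coeff_zero, h'.coeff_zero, map_zero, mul_one] at this
    exact (sub_eq_zero.1 this).symm
  rw [hq1, map_one, one_mul, sub_eq_zero] at hS
  refine ⟨(Polynomial.coe_injective F hS).symm, ?_⟩
  have := h.2.2.2.2.symm.trans h'.2.2.2.2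
  rw [hS] at this
  exact mul_left_cancel₀ h2.not_eq_zero this

lemma exists_isSlopeFactorization [CompleteSpace F] (hr : 0 < r) (hrR : r ≤ R) (hd : 0 < d)
    (hφ : PowerSeries.IsRestricted R φ) (hk : FirstDominant r φ k)
    (hl : LastDominant r φ (k + d)) :
    ∃ (P : F[X]) (ψ : F⟦X⟧), IsSlopeFactorization R φ d (Real.log r) P ψ := by
  obtain ⟨Q, ψ, h1, h2, h3, h4, h5, rfl⟩ := exists_factorization hr (hφ.of_le hr hrR) hk hl
  set P : F[X] := PowerSeries.trunc (d + 1) Q with hP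
  have hPQ : (P : F⟦X⟧) = Q := by
    ext n
    rw [Polynomial.coeff_coe, hP, PowerSeries.coeff_trunc]
    split_ifs with hn
    · rfl
    · exact (h2 n (by omega)).symm
  have hdeg : P.natDegree = d := by
    refine le_antisymm (Polynomial.natDegree_le_iff_coeff_eq_zero.2 fun n hn => ?_)
      (Polynomial.le_natDegree_of_ne_zero ?_)
    · rw [← Polynomial.coeff_coe, hPQ, h2 n hn]
    · rw [← Polynomial.coeff_coe, hPQ]
      exact h4.1.1
  refine ⟨P, ψ, hdeg, ?_, ?_, h5.of_mul hr hrR h4 h2 hφ, by rw [hPQ]⟩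
  · rw [← Polynomial.coeff_zero_eq_eval_zero, ← Polynomial.coeff_coe, hPQ, h1]
  · refine (forall_isSlope_iff_dominantAt hr (hdeg ▸ hd) (by rw [hPQ, h1]; exact one_ne_zero)).2 ?_
    rw [hdeg, hPQ]
    exact ⟨h3, h4⟩

/-- The bound at s > r makes ψ restricted at some ρ > r even when r = R. This room lets the single
dominant index persist on both sides of r. -/
lemma IsSlopeFactorization.not_isSlope_snd {s M : ℝ} (hr : 0 < r) (hrR : r ≤ R) (hrs : r < s)
    (hd : 0 < d) (hb : ∀ n, ‖PowerSeries.coeff n φ‖ * s ^ n ≤ M)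
    (hk : FirstDominant r φ k) (hl : LastDominant r φ (k + d))
    (h : IsSlopeFactorization R φ d (Real.log r) P ψ) :
    ¬ IsSlope (newtonPolygon ψ) (Real.log r) := by
  obtain ⟨ρ, hrρ, hρs⟩ := exists_between hrs
  obtain ⟨h1, h2⟩ := h.dominant_snd hr hrR hd hk hl
  have hφρ := isRestricted_of_bound (hr.trans hrρ) hρs hb
  rw [h.2.2.2.2] at hφρ
  have hψ : PowerSeries.IsRestricted ρ ψ :=
    (h.2.2.2.1.of_le hr hrR).of_mul hr hrρ.le (h.dominant hr hd).2
      (fun n hn => coeff_coe_eq_zero (h.1 ▸ hn)) hφρ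
  exact not_isSlope_of_firstDominant_lastDominant hr hrρ hψ h1 h2

end SlopeFactorization

theorem mainTheorem7 {F : Type*} [NontriviallyNormedField F] [IsUltrametricDist F]
    [CompleteSpace F] (R : ℝ) (hR : 0 < R) (φ : F⟦X⟧) (hφ : PowerSeries.IsRestricted R φ)
    (hpol : ∀ p : F[X], (p : F⟦X⟧) ≠ φ) (h0 : PowerSeries.coeff 0 φ ≠ 0) :
    -- finite, continuous, convex and piecewise affine on the nonnegative reals
    ((∀ t : ℝ, 0 ≤ t → newtonPolygon φ t ≠ ⊥ ∧ newtonPolygon φ t ≠ ⊤) ∧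
      ContinuousOn (newtonPolygon φ) (Ici 0) ∧
      ConvexOn ℝ (Ici 0) (fun t => (newtonPolygon φ t).toReal) ∧
      PiecewiseAffineOnNonneg (newtonPolygon φ)) ∧
    -- the break points
    ((∀ t : ℝ, IsBreakPoint (newtonPolygon φ) t →
        ∃ n : ℕ, t = n ∧ newtonPolygon φ t = -ENNReal.log ‖PowerSeries.coeff n φ‖ₑ) ∧
      IsBreakPoint (newtonPolygon φ) 0) ∧
    -- the zeros
    (∀ a : F, ‖a‖ ≤ R → HasSum (fun n : ℕ => PowerSeries.coeff n φ * a ^ n) 0 →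
      IsSlope (newtonPolygon φ) (Real.log ‖a‖)) ∧
    -- the segments
    (∀ k l : ℕ, ConsecutiveBreakPoints (newtonPolygon φ) k l →
      ∃ μ : ℝ, HasSlopeOn (newtonPolygon φ) μ k l ∧
        (μ : EReal) < ENNReal.log (convergenceRadius φ) ∧
        (μ ≤ Real.log R →
          (∃! Pψ : F[X] × F⟦X⟧, IsSlopeFactorization R φ (l - k) μ Pψ.1 Pψ.2) ∧
          ∀ (P : F[X]) (ψ : F⟦X⟧), IsSlopeFactorization R φ (l - k) μ P ψ →
            ¬ IsSlope (newtonPolygon ψ) μ)) := by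
  choose s hs using exists_isCritical_of_ne_coe hR hφ hpol h0
  refine ⟨⟨fun t ht => newtonPolygon_ne_bot_ne_top hs ht, continuousOn_newtonPolygon hs,
    convexOn_newtonPolygon hs, piecewiseAffineOnNonneg_newtonPolygon hs⟩,
    ⟨fun t ht => ?_, isBreakPoint_zero hR hφ h0 hs⟩,
    fun a haR ha => isSlope_of_hasSum_zero hφ h0 haR ha, fun k l hkl => ?_⟩
  · obtain ⟨n, rfl, hn⟩ := ht.exists_nat hR hφ h0 hs
    refine ⟨n, rfl, ?_⟩
    rw [hn.newtonPolygon_natCast (hs n).1, ← ofReal_norm,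
      ENNReal.log_ofReal_of_pos (norm_pos_iff.2 hn.1), EReal.coe_neg]
  · obtain ⟨hk, hl, hlt⟩ := hkl.dominant hs
    have hkl' : k < l := by exact_mod_cast hkl.1
    have hr := (hs k).1
    -- Dominance of l at s l bounds all terms of φ at a radius strictly beyond s k; both the strict
    -- inequality with R_φ and the claim on the slopes of ψ rest on it.
    have hb := (hkl.2.2.1.dominantAt hs).2
    refine ⟨Real.log (s k), hk.1.hasSlopeOn hr hl.1 hkl',
      log_lt_log_convergenceRadius hr hlt hb, fun hμ => ?_⟩
    have hrR : s k ≤ R := (Real.log_le_log_iff hr hR).1 hμ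
    obtain ⟨d, rfl⟩ : ∃ d, l = k + d := ⟨l - k, by omega⟩
    have hd : 0 < d := by omega
    rw [Nat.add_sub_cancel_left]
    obtain ⟨P, ψ, h⟩ := exists_isSlopeFactorization hr hrR hd hφ hk hl
    refine ⟨⟨(P, ψ), h, fun Q hQ => ?_⟩, fun P ψ h => h.not_isSlope_snd hr hrR hlt hd hb hk hl⟩
    obtain ⟨h1, h2⟩ := hQ.unique hr hrR hd hk hl h
    exact Prod.ext h1 h2
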